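/- Let $k$ be a field of characteristic zero, $X$ a finite alphabet, $X^*$ the free monoid on $X$, and let $S:X^*\to k$, $w\mapsto S_w$, be a formal series, regarded also as a linear functional on the free algebra $k\langle X\rangle$. Let $I_S$ be the largest two-sided ideal of $k\langle X\rangle$ contained in $\ker S$, and let $\mathfrak A_S=k\langle X\rangle/I_S$ be the syntactic algebra of $S$. Then the following are equivalent: 1. $\dim_k(\mathfrak A_S)<\infty$; 2. $S$ is rational, i.e. $S$ belongs to the smallest class of formal series that contains the polynomials and is closed under sum, scalar multiplication, the product $(ST)_w=\sum_{w=uv}S_uT_v$, and the star $S^*=\sum_{n\ge 0}S^n$ of series with zero constant coefficient; 3. $S$ is recognisable, i.e. there are $n\ge 0$, $\lambda\in k^{1\times n}$, $\gamma\in k^{n\times 1}$ and a monoid homomorphism $\mu:X^*\to k^{n\times n}$ with $S_w=\lambda\,\mu(w)\,\gamma$ for all $w\in X^*$; 4. $S$ is $\mathrm{rwMSO}(k,X)$-definable, i.e. there is a restricted weighted MSO sentence $\varphi$ with $[\![\varphi]\!](w)=S_w$ for all $w\in X^*$. Here Boolean formulas are given by $\beta::=P_a(x)\mid x\le y\mid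 x\in Y\mid\neg\beta\mid\beta\wedge\beta\mid\forall x.\beta\mid\forall Y.\beta$ (with $a\in X$, position variables $x,y$ and set variables $Y$), interpreted over the positions of a word in the usual way, and weighted MSO formulas by $\varphi::=c\mid\beta\mid\varphi\vee\varphi\mid\varphi\wedge\varphi\mid\exists x.\varphi\mid\forall x.\varphi\mid\exists Y.\varphi\mid\forall Y.\varphi$ with $c\in k$. In the weighted semantics $c$ has the value $c$, a Boolean formula has the value $1$ or $0$, $\vee$ and $\exists$ are interpreted by sums in $k$, and $\wedge$ and $\forall$ by products in $k$, where the quantifiers range over all positions, respectively all sets of positions, of $w$. Almost Boolean formulas are those obtained from constants and Boolean formulas by $\vee$ and $\wedge$. A formula is restricted if $\psi$ is almost Boolean for each of its subformulas $\forall x.\psi$, and $\psi$ is Boolean for each of its subformulas $\forall Y.\psi$. -/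

import Mathlib

noncomputable section

namespace NCSeries

/-- A formal series over the alphabet `X` with coefficients in `k`. (The pointwise structure on
this function space supplies sum, scalar multiples and the Hadamard product; the product of the
algebra of formal series is `cauchyMul` below.) -/
abbrev FormalSeries (k X : Type*) := FreeMonoid X → k

/-- The algebra `k⟨X⟩` of noncommutative polynomials, i.e. the monoid algebra of the free monoid,
which is the free associative unital algebra on `X`. -/
abbrev NCPoly (k X : Type*) [Field k] := MonoidAlgebra k (FreeMonoid X)

/-! ### The syntactic algebra -/

section Syntactic

variable {k X : Type*} [Field k]

/-- The linear functional on `k⟨X⟩` given by linear extension of `w ↦ S w`. -/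
def functional (S : FormalSeries k X) : NCPoly k X →ₗ[k] k :=
  Finsupp.linearCombination k S ∘ₗ (MonoidAlgebra.coeffLinearEquiv k).toLinearMap

/-- The syntactic ideal: the supremum of all two-sided ideals contained in the kernel of `S`. -/
def syntacticIdeal (S : FormalSeries k X) : TwoSidedIdeal (NCPoly k X) :=
  sSup {J | ∀ p ∈ J, functional S p = 0}

/-- The syntactic ideal is the largest two-sided ideal contained in the kernel of `S`. -/
theorem syntacticIdeal_isGreatest (S : FormalSeries k X) :
    IsGreatest {J : TwoSidedIdeal (NCPoly k X) | ∀ p ∈ J, functional S p = 0}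
      (syntacticIdeal S) := by
  refine ⟨?_, fun J hJ => le_sSup hJ⟩
  let K : TwoSidedIdeal (NCPoly k X) := .mk' {p | ∀ a b, functional S (a * p * b) = 0}
    (by simp) (by intro x y hx hy a b; simp [mul_add, add_mul, hx a b, hy a b])
    (by intro x hx a b; simp [hx a b])
    (by intro x y hy a b; simpa [mul_assoc] using hy (a * x) b)
    (by intro x y hy a b; simpa [mul_assoc] using hy a (y * b))
  have hK : syntacticIdeal S ≤ K := by
    refine sSup_le fun J hJ p hp => ?_
    simp only [K, TwoSidedIdeal.mem_mk']
    exact fun a b => hJ _ (J.mul_mem_right _ _ (J.mul_mem_left _ _ hp))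
  intro p hp
  have h := hK hp
  simp only [K, TwoSidedIdeal.mem_mk'] at h
  simpa using h 1 1

/-- The syntactic algebra `k⟨X⟩ / I_S`. -/
abbrev SyntacticAlgebra (S : FormalSeries k X) : Type _ :=
  (syntacticIdeal S).ringCon.Quotient

end Syntactic

/-! ### Rational series -/

section Rational

variable {k X : Type*} [Field k]

/-- The unit of the algebra of formal series. -/
def unit : FormalSeries k X := fun w => if w.length = 0 then 1 else 0

/-- The (Cauchy) product of formal series: `(S T)(w) = ∑_{w = u v} S(u) T(v)`. -/
def cauchyMul (S T : FormalSeries k X) : FormalSeries k X := fun w =>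
  ∑ i ∈ Finset.range (w.length + 1),
    S (FreeMonoid.ofList (w.toList.take i)) * T (FreeMonoid.ofList (w.toList.drop i))

/-- Powers with respect to the Cauchy product. -/
def cauchyPow (S : FormalSeries k X) : ℕ → FormalSeries k X
  | 0 => unit
  | n + 1 => cauchyMul S (cauchyPow S n)

/-- A series is proper if its constant coefficient vanishes. -/
def IsProper (S : FormalSeries k X) : Prop := S 1 = 0

theorem cauchyPow_eq_zero {S : FormalSeries k X} (hS : IsProper S) (n : ℕ) (w : FreeMonoid X)
    (h : w.length < n) : cauchyPow S n w = 0 := by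
  induction n generalizing w with
  | zero => simp at h
  | succ n ih =>
    unfold cauchyPow cauchyMul
    refine Finset.sum_eq_zero fun i hi => ?_
    rcases Nat.eq_zero_or_pos i with rfl | hi0
    · have h0 : S (FreeMonoid.ofList (List.take 0 w.toList)) = 0 := hS
      rw [h0, zero_mul]
    · rw [ih, mul_zero]
      simp only [FreeMonoid.length, FreeMonoid.toList_ofList, List.length_drop] at *
      simp at hi
      omega

/-- The star `S^* = ∑_{n ≥ 0} S^n`, used for proper `S` only. For such `S` one has `S^n (w) = 0`
whenever `n > |w|`, so that the sum may be cut off at `n = |w|`. -/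
def kleeneStar (S : FormalSeries k X) : FormalSeries k X := fun w =>
  ∑ n ∈ Finset.range (w.length + 1), cauchyPow S n w

/-- The rational series: the smallest class of series that contains the polynomials and is closed
under sum, scalar multiplication, product, and star of proper series. -/
inductive IsRational : FormalSeries k X → Prop
  | polynomial (S : FormalSeries k X) (h : (Function.support S).Finite) : IsRational S
  | add {S T : FormalSeries k X} : IsRational S → IsRational T → IsRational (S + T)
  | smul (c : k) {S : FormalSeries k X} : IsRational S → IsRational (c • S)
  | mul {S T : FormalSeries k X} : IsRational S → IsRational T → IsRational (cauchyMul S T)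
  | star {S : FormalSeries k X} : IsRational S → IsProper S → IsRational (kleeneStar S)

/-- The recognisable series: the behaviours of finite weighted automata, given by an initial
vector, transition matrices extended multiplicatively to words, and a final vector. -/
def IsRecognisable (S : FormalSeries k X) : Prop :=
  ∃ (n : ℕ) (lam : Fin n → k) (mu : FreeMonoid X →* Matrix (Fin n) (Fin n) k) (gam : Fin n → k),
    ∀ w : FreeMonoid X, S w = dotProduct lam ((mu w).mulVec gam)

end Rational

/-! ### Weighted monadic second-order logic

Formulas are indexed by the numbers `n` and `m` of first-order and of set variables that may occur
free. A quantifier binds the variable with index `0` and shifts the others. -/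

/-- Boolean (unweighted) MSO formulas over words with letters in `X`. Disjunction and existential
quantification are the usual abbreviations. -/
inductive BoolMSO (X : Type*) : ℕ → ℕ → Type _
  /-- the position `x` carries the letter `a` -/
  | letter {n m : ℕ} (a : X) (x : Fin n) : BoolMSO X n m
  /-- `x ≤ y` -/
  | le {n m : ℕ} (x y : Fin n) : BoolMSO X n m
  /-- `x ∈ Y` -/
  | mem {n m : ℕ} (x : Fin n) (Y : Fin m) : BoolMSO X n m
  | not {n m : ℕ} (φ : BoolMSO X n m) : BoolMSO X n m
  | and {n m : ℕ} (φ ψ : BoolMSO X n m) : BoolMSO X n m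
  | allFO {n m : ℕ} (φ : BoolMSO X (n + 1) m) : BoolMSO X n m
  | allSO {n m : ℕ} (φ : BoolMSO X n (m + 1)) : BoolMSO X n m

/-- Satisfaction of a Boolean formula in the word `w`; `ρ` assigns positions of `w` to the
first-order variables and `σ` assigns sets of positions to the set variables. -/
def BoolMSO.Sat {X : Type*} (w : List X) : {n m : ℕ} → BoolMSO X n m →
    (Fin n → Fin w.length) → (Fin m → Finset (Fin w.length)) → Prop
  | _, _, .letter a x, ρ, _ => w.get (ρ x) = a
  | _, _, .le x y, ρ, _ => ρ x ≤ ρ y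
  | _, _, .mem x Y, ρ, σ => ρ x ∈ σ Y
  | _, _, .not φ, ρ, σ => ¬ φ.Sat w ρ σ
  | _, _, .and φ ψ, ρ, σ => φ.Sat w ρ σ ∧ ψ.Sat w ρ σ
  | _, _, .allFO φ, ρ, σ => ∀ i : Fin w.length, φ.Sat w (Fin.cons i ρ) σ
  | _, _, .allSO φ, ρ, σ => ∀ P : Finset (Fin w.length), φ.Sat w ρ (Fin.cons P σ)

/-- Weighted MSO formulas over `k` and `X`. -/
inductive WMSO (k X : Type*) : ℕ → ℕ → Type _
  | const {n m : ℕ} (c : k) : WMSO k X n m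
  | bool {n m : ℕ} (β : BoolMSO X n m) : WMSO k X n m
  | or {n m : ℕ} (φ ψ : WMSO k X n m) : WMSO k X n m
  | and {n m : ℕ} (φ ψ : WMSO k X n m) : WMSO k X n m
  | exFO {n m : ℕ} (φ : WMSO k X (n + 1) m) : WMSO k X n m
  | allFO {n m : ℕ} (φ : WMSO k X (n + 1) m) : WMSO k X n m
  | exSO {n m : ℕ} (φ : WMSO k X n (m + 1)) : WMSO k X n m
  | allSO {n m : ℕ} (φ : WMSO k X n (m + 1)) : WMSO k X n m

namespace WMSO

variable {k X : Type*}

open scoped Classical in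
/-- The semantics of weighted MSO: Boolean formulas take the values `0` and `1`, disjunction and
existential quantifiers are sums, conjunction and universal quantifiers are products; set
quantifiers range over all sets of positions. -/
def eval [Field k] (w : List X) : {n m : ℕ} → WMSO k X n m →
    (Fin n → Fin w.length) → (Fin m → Finset (Fin w.length)) → k
  | _, _, .const c, _, _ => c
  | _, _, .bool β, ρ, σ => if β.Sat w ρ σ then 1 else 0
  | _, _, .or φ ψ, ρ, σ => φ.eval w ρ σ + ψ.eval w ρ σ
  | _, _, .and φ ψ, ρ, σ => φ.eval w ρ σ * ψ.eval w ρ σ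
  | _, _, .exFO φ, ρ, σ => ∑ i : Fin w.length, φ.eval w (Fin.cons i ρ) σ
  | _, _, .allFO φ, ρ, σ => ∏ i : Fin w.length, φ.eval w (Fin.cons i ρ) σ
  | _, _, .exSO φ, ρ, σ => ∑ P : Finset (Fin w.length), φ.eval w ρ (Fin.cons P σ)
  | _, _, .allSO φ, ρ, σ => ∏ P : Finset (Fin w.length), φ.eval w ρ (Fin.cons P σ)

/-- The weighted formulas that are Boolean MSO formulas: built from Boolean formulas by
conjunction and universal quantifiers. -/
def IsBoolean : {n m : ℕ} → WMSO k X n m → Prop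
  | _, _, .bool _ => True
  | _, _, .and φ ψ => φ.IsBoolean ∧ ψ.IsBoolean
  | _, _, .allFO φ => φ.IsBoolean
  | _, _, .allSO φ => φ.IsBoolean
  | _, _, .const _ => False
  | _, _, .or _ _ => False
  | _, _, .exFO _ => False
  | _, _, .exSO _ => False

/-- The almost Boolean formulas: the smallest class that contains the constants and the Boolean
formulas and is closed under disjunction and conjunction. -/
inductive IsAlmostBoolean : {n m : ℕ} → WMSO k X n m → Prop
  | const {n m : ℕ} (c : k) : IsAlmostBoolean (WMSO.const c : WMSO k X n m)
  | boolean {n m : ℕ} {φ : WMSO k X n m} : φ.IsBoolean → IsAlmostBoolean φ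
  | or {n m : ℕ} {φ ψ : WMSO k X n m} :
      IsAlmostBoolean φ → IsAlmostBoolean ψ → IsAlmostBoolean (WMSO.or φ ψ)
  | and {n m : ℕ} {φ ψ : WMSO k X n m} :
      IsAlmostBoolean φ → IsAlmostBoolean ψ → IsAlmostBoolean (WMSO.and φ ψ)

/-- The restricted formulas: universal first-order quantification is applied to almost Boolean
formulas only, and universal set quantification to Boolean formulas only. -/
def IsRestricted : {n m : ℕ} → WMSO k X n m → Prop
  | _, _, .const _ => True
  | _, _, .bool _ => True
  | _, _, .or φ ψ => φ.IsRestricted ∧ ψ.IsRestricted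
  | _, _, .and φ ψ => φ.IsRestricted ∧ ψ.IsRestricted
  | _, _, .exFO φ => φ.IsRestricted
  | _, _, .exSO φ => φ.IsRestricted
  | _, _, .allFO φ => φ.IsAlmostBoolean
  | _, _, .allSO φ => φ.IsBoolean

end WMSO

/-- `S` is `rwMSO(k, X)`-definable: it is the semantics of a restricted weighted MSO sentence, that
is, of a restricted formula without free variables. -/
def IsRwMSODefinable {k X : Type*} [Field k] (S : FormalSeries k X) : Prop :=
  ∃ φ : WMSO k X 0 0, φ.IsRestricted ∧
    ∀ w : FreeMonoid X, S w = φ.eval w.toList Fin.elim0 Fin.elim0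

end NCSeries

end

/-!
All four conditions say that `S` generates only a finite-dimensional space under left quotients
`a⁻¹ S : w ↦ S (a w)`, which is the predicate `HasFiniteRankQuotients`. In a basis of such a
space the quotients become matrices, and these recognise `S`
(`HasFiniteRankQuotients.isRecognisable`).

*Syntactic algebra.* If `μ` recognises `S`, then the kernel of its extension to `k⟨X⟩` is a
two-sided ideal inside `ker S`, so `𝔄_S` is a quotient of an algebra of matrices. Conversely the
regular representation of a finite-dimensional `𝔄_S` recognises `S`.

*Rational series (Kleene–Schützenberger).* The identities
`a⁻¹ (S T) = (a⁻¹ S) T + S(1) a⁻¹ T` and `a⁻¹ S^* = (a⁻¹ S) S^*` show that having finite rank is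
preserved by the rational operations. In the other direction, the series `w ↦ (μ(w) γ) i` solve a
proper linear system with polynomial coefficients, and Gaussian elimination with Arden's lemma
expresses them by rational operations (`isRational_of_linear_system`).

*From formulas to finite rank.* A word with an assignment of variables is encoded as a word over an
alphabet of marked letters. By induction on a formula there is a series of finite rank that takes
the right value at each encoding; its values at other words do not matter. For Boolean and almost
Boolean formulas the series even has finitely many quotients (`HasFinitelyManyQuotients`), which is
Büchi's theorem. A product over all positions of such a series again has finite rank
(`HasFinitelyManyQuotients.prodPositions`); this is where the restriction on universal
quantifiers is used. Sums over positions and over sets of positions preserve finite rank.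

*From automata to formulas.* If the states are the bit vectors of length `n`, then sequences of
states are the same as `n`-tuples of sets of positions. The weight of a word is the sum over all
such tuples of a product of local weights, one for each position, and a local weight depends only on
finitely many MSO-definable data, so it is the value of an almost Boolean formula
(`HasDefinableFibres.isAlmostBooleanDefinable`).
-/

noncomputable section

namespace NCSeries

/-! ### Left quotients of functions on words -/

section Quotients

variable {k A B R : Type*}

/-- The left quotient `a⁻¹ f` of a function on words by a letter: `(a⁻¹ f) w = f (a w)`. -/
def leftQuot (a : A) (f : FreeMonoid A → R) : FreeMonoid A → R :=
  fun w => f (FreeMonoid.of a * w)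

@[simp]
theorem leftQuot_apply (a : A) (f : FreeMonoid A → R) (w : FreeMonoid A) :
    leftQuot a f w = f (FreeMonoid.of a * w) := rfl

theorem ext_word {f g : FreeMonoid A → R} (h1 : f 1 = g 1)
    (h : ∀ a w, f w = g w → f (FreeMonoid.of a * w) = g (FreeMonoid.of a * w)) : f = g := by
  funext w
  induction w using FreeMonoid.inductionOn' with
  | one => exact h1
  | of_mul a w ih => exact h a w ih

/-- `S` lies in a finite-dimensional space of series that is stable under left quotients;
equivalently, all iterated left quotients of `S` span a finite-dimensional space. -/
def HasFiniteRankQuotients [Field k] (S : FreeMonoid A → k) : Prop :=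
  ∃ V : Submodule k (FreeMonoid A → k), V.FG ∧ S ∈ V ∧ ∀ a, ∀ f ∈ V, leftQuot a f ∈ V

/-- `f` has finitely many iterated left quotients. For a finite alphabet this says, by the
Myhill–Nerode theorem, that `f` takes finitely many values and that its fibres are
regular languages. -/
def HasFinitelyManyQuotients (f : FreeMonoid A → R) : Prop :=
  ∃ Q : Set (FreeMonoid A → R), Q.Finite ∧ f ∈ Q ∧ ∀ a, ∀ g ∈ Q, leftQuot a g ∈ Q

namespace HasFiniteRankQuotients

variable [Field k] {S T : FreeMonoid A → k}

theorem add (hS : HasFiniteRankQuotients S) (hT : HasFiniteRankQuotients T) :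
    HasFiniteRankQuotients (S + T) := by
  obtain ⟨V, hV, hSV, hVq⟩ := hS
  obtain ⟨W, hW, hTW, hWq⟩ := hT
  refine ⟨V ⊔ W, hV.sup hW, Submodule.add_mem_sup hSV hTW, fun a f hf => ?_⟩
  obtain ⟨g, hg, h, hh, rfl⟩ := Submodule.mem_sup.mp hf
  exact Submodule.add_mem_sup (hVq a g hg) (hWq a h hh)

theorem smul (c : k) (hS : HasFiniteRankQuotients S) : HasFiniteRankQuotients (c • S) := by
  obtain ⟨V, hV, hSV, hVq⟩ := hS
  exact ⟨V, hV, V.smul_mem c hSV, hVq⟩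

/-- Closure under the Hadamard (pointwise) product. -/
theorem mul (hS : HasFiniteRankQuotients S) (hT : HasFiniteRankQuotients T) :
    HasFiniteRankQuotients (S * T) := by
  obtain ⟨V, hV, hSV, hVq⟩ := hS
  obtain ⟨W, hW, hTW, hWq⟩ := hT
  refine ⟨V * W, hV.mul hW, Submodule.mul_mem_mul hSV hTW, fun a f hf => ?_⟩
  induction hf using Submodule.mul_induction_on' with
  | mem_mul_mem g hg h hh => exact Submodule.mul_mem_mul (hVq a g hg) (hWq a h hh)
  | add g _ h _ ihg ihh => exact (V * W).add_mem ihg ihh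

theorem comp_map (e : B → A) (hS : HasFiniteRankQuotients S) :
    HasFiniteRankQuotients fun w => S (FreeMonoid.map e w) := by
  obtain ⟨V, hV, hSV, hVq⟩ := hS
  refine ⟨V.map (LinearMap.funLeft k k (FreeMonoid.map e)), hV.map _, ⟨S, hSV, rfl⟩, ?_⟩
  rintro a _ ⟨f, hf, rfl⟩
  refine ⟨leftQuot (e a) f, hVq _ f hf, funext fun w => ?_⟩
  simp [LinearMap.funLeft_apply]

end HasFiniteRankQuotients

namespace HasFinitelyManyQuotients

theorem comp (F : R → k) {f : FreeMonoid A → R} (hf : HasFinitelyManyQuotients f) :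
    HasFinitelyManyQuotients fun w => F (f w) := by
  obtain ⟨Q, hQ, hfQ, hq⟩ := hf
  refine ⟨(fun g w => F (g w)) '' Q, hQ.image _, ⟨f, hfQ, rfl⟩, ?_⟩
  rintro a _ ⟨g, hg, rfl⟩
  exact ⟨leftQuot a g, hq a g hg, rfl⟩

theorem comp₂ {R' : Type*} (F : R → R' → k) {f : FreeMonoid A → R} {f' : FreeMonoid A → R'}
    (hf : HasFinitelyManyQuotients f) (hf' : HasFinitelyManyQuotients f') :
    HasFinitelyManyQuotients fun w => F (f w) (f' w) := by
  obtain ⟨Q, hQ, hfQ, hq⟩ := hf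
  obtain ⟨Q', hQ', hfQ', hq'⟩ := hf'
  refine ⟨Set.image2 (fun g g' w => F (g w) (g' w)) Q Q', hQ.image2 _ hQ',
    ⟨f, hfQ, f', hfQ', rfl⟩, ?_⟩
  rintro a _ ⟨g, hg, g', hg', rfl⟩
  exact ⟨leftQuot a g, hq a g hg, leftQuot a g', hq' a g' hg', rfl⟩

theorem comp_map (e : B → A) {f : FreeMonoid A → R} (hf : HasFinitelyManyQuotients f) :
    HasFinitelyManyQuotients fun w => f (FreeMonoid.map e w) := by
  obtain ⟨Q, hQ, hfQ, hq⟩ := hf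
  refine ⟨(fun g w => g (FreeMonoid.map e w)) '' Q, hQ.image _, ⟨f, hfQ, rfl⟩, ?_⟩
  rintro a _ ⟨g, hg, rfl⟩
  exact ⟨leftQuot (e a) g, hq _ g hg, funext fun w => by simp⟩

theorem const (c : R) : HasFinitelyManyQuotients fun _ : FreeMonoid A => c :=
  ⟨{fun _ => c}, Set.finite_singleton _, rfl, by rintro a _ rfl; rfl⟩

theorem hasFiniteRankQuotients [Field k] {f : FreeMonoid A → k}
    (hf : HasFinitelyManyQuotients f) : HasFiniteRankQuotients f := by
  obtain ⟨Q, hQ, hfQ, hq⟩ := hf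
  refine ⟨Submodule.span k Q, Submodule.fg_span hQ, Submodule.subset_span hfQ, fun a g hg => ?_⟩
  induction hg using Submodule.span_induction with
  | mem g hg => exact Submodule.subset_span (hq a g hg)
  | zero => exact Submodule.zero_mem _
  | add g h _ _ ihg ihh => exact Submodule.add_mem _ ihg ihh
  | smul c g _ ih => exact Submodule.smul_mem _ c ih

end HasFinitelyManyQuotients

end Quotients

/-! ### Recognisable series and finite rank -/

section Recognisable

variable {k X : Type*} [Field k] {S : FormalSeries k X}

/-- The entries of `w ↦ μ(w) γ` span a space of series stable under left quotients. -/
theorem IsRecognisable.hasFiniteRankQuotients (h : IsRecognisable S) :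
    HasFiniteRankQuotients S := by
  obtain ⟨n, lam, mu, gam, h⟩ := h
  let x : Fin n → FreeMonoid X → k := fun i w => (mu w).mulVec gam i
  refine ⟨Submodule.span k (Set.range x), Submodule.fg_span (Set.finite_range x), ?_,
    fun a f hf => ?_⟩
  · have : S = ∑ i, lam i • x i := by
      funext w
      simp [h w, dotProduct, x]
    rw [this]
    exact Submodule.sum_mem _ fun i _ => Submodule.smul_mem _ _ (Submodule.subset_span ⟨i, rfl⟩)
  · induction hf using Submodule.span_induction with
    | mem g hg =>
      obtain ⟨i, rfl⟩ := hg
      have : leftQuot a (x i) = ∑ j, mu (FreeMonoid.of a) i j • x j := by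
        funext w
        simp only [leftQuot_apply, x, map_mul, ← Matrix.mulVec_mulVec]
        simp [Matrix.mulVec, dotProduct]
      rw [this]
      exact Submodule.sum_mem _ fun j _ => Submodule.smul_mem _ _ (Submodule.subset_span ⟨j, rfl⟩)
    | zero => exact Submodule.zero_mem _
    | add g h _ _ ihg ihh => exact Submodule.add_mem _ ihg ihh
    | smul c g _ ih => exact Submodule.smul_mem _ c ih

/-- In a basis of a space of series stable under left quotients, the quotient by `a` has a matrix
`M a`. As `w ↦ w⁻¹` reverses products, the transposes `(M a)ᵀ` are the transition matrices. -/
theorem HasFiniteRankQuotients.isRecognisable (h : HasFiniteRankQuotients S) :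
    IsRecognisable S := by
  obtain ⟨V, hV, hS, hq⟩ := h
  have : Module.Finite k V := Module.Finite.iff_fg.mpr hV
  let b := Module.finBasis k V
  let q : X → V →ₗ[k] V := fun a =>
    { toFun := fun f => ⟨leftQuot a f, hq a f f.2⟩
      map_add' := fun f g => rfl
      map_smul' := fun c f => rfl }
  let gam : Fin (Module.finrank k V) → k := fun i => (b i : FreeMonoid X → k) 1
  let mu : FreeMonoid X →* Matrix (Fin (Module.finrank k V)) (Fin (Module.finrank k V)) k :=
    FreeMonoid.lift fun a => (LinearMap.toMatrix b b (q a)).transpose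
  refine ⟨_, b.repr ⟨S, hS⟩, mu, gam, fun w => ?_⟩
  suffices H : ∀ f : V, (f : FreeMonoid X → k) w = dotProduct (b.repr f) ((mu w).mulVec gam) from
    H ⟨S, hS⟩
  induction w using FreeMonoid.inductionOn' with
  | one =>
    intro f
    have := congrArg (fun g : V => (g : FreeMonoid X → k) 1) (b.sum_repr f)
    simp only [AddSubmonoidClass.coe_finsetSum, Finset.sum_apply, SetLike.val_smul,
      Pi.smul_apply, smul_eq_mul] at this
    simp [← this, dotProduct, gam]
  | of_mul a w ih =>
    intro f
    have h1 : (f : FreeMonoid X → k) (FreeMonoid.of a * w) = (q a f : FreeMonoid X → k) w := rfl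
    rw [h1, ih, map_mul, ← Matrix.mulVec_mulVec, Matrix.dotProduct_mulVec _ (mu (FreeMonoid.of a)),
      ← LinearMap.toMatrix_mulVec_repr b b (q a) f]
    simp [mu, Matrix.vecMul_transpose]

end Recognisable

/-! ### The syntactic algebra -/

section Syntactic

variable {k X : Type*} [Field k] {S : FormalSeries k X}

@[simp]
theorem functional_single (S : FormalSeries k X) (w : FreeMonoid X) (c : k) :
    functional S (MonoidAlgebra.single w c) = c * S w := by
  simp [functional]

/-- The projection `k⟨X⟩ → 𝔄_S`. -/
def syntacticMk (S : FormalSeries k X) : NCPoly k X →ₐ[k] SyntacticAlgebra S :=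
  (syntacticIdeal S).ringCon.mkₐ k

theorem syntacticMk_surjective (S : FormalSeries k X) : Function.Surjective (syntacticMk S) :=
  RingCon.mkₐ_surjective (α := k) _

theorem syntacticMk_eq_zero {p : NCPoly k X} : syntacticMk S p = 0 ↔ p ∈ syntacticIdeal S := by
  rw [TwoSidedIdeal.mem_iff, ← RingCon.eq]
  rfl

/-- The kernel of the algebra homomorphism that extends `μ` is a two-sided ideal in `ker S`, so the
syntactic algebra is a quotient of a subalgebra of a matrix algebra. -/
theorem IsRecognisable.finiteDimensional (h : IsRecognisable S) :
    FiniteDimensional k (SyntacticAlgebra S) := by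
  obtain ⟨n, lam, mu, gam, h⟩ := h
  let Φ := MonoidAlgebra.lift k (Matrix (Fin n) (Fin n) k) (FreeMonoid X) mu
  have hS : ∀ p, functional S p = dotProduct lam ((Φ p).mulVec gam) := by
    intro p
    induction p using MonoidAlgebra.induction_linear with
    | zero => simp
    | add p q hp hq => simp [hp, hq, Matrix.add_mulVec]
    | single w c => simp [Φ, h, Matrix.smul_mulVec]
  have hle : TwoSidedIdeal.ker Φ ≤ syntacticIdeal S := by
    refine (syntacticIdeal_isGreatest S).2 fun p hp => ?_
    rw [TwoSidedIdeal.mem_ker] at hp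
    simp [hS, hp]
  have hker : LinearMap.ker Φ.toLinearMap ≤ LinearMap.ker (syntacticMk S).toLinearMap := fun p hp =>
    syntacticMk_eq_zero.mpr (hle ((TwoSidedIdeal.mem_ker _).mpr hp))
  have : Module.Finite k (NCPoly k X ⧸ LinearMap.ker Φ.toLinearMap) :=
    Module.Finite.equiv Φ.toLinearMap.quotKerEquivRange.symm
  refine Module.Finite.of_surjective
    ((LinearMap.ker Φ.toLinearMap).liftQ (syntacticMk S).toLinearMap hker) fun y => ?_
  obtain ⟨p, rfl⟩ := syntacticMk_surjective S y
  exact ⟨Submodule.Quotient.mk p, by simp⟩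

/-- `S` factors through its syntactic algebra, whose regular representation recognises it. -/
theorem isRecognisable_of_finiteDimensional (h : FiniteDimensional k (SyntacticAlgebra S)) :
    IsRecognisable S := by
  let b := Module.finBasis k (SyntacticAlgebra S)
  -- A linear section of the projection gives the functional induced by `S` on the quotient.
  obtain ⟨r, hr⟩ := (syntacticMk S).toLinearMap.exists_rightInverse_of_surjective
    (LinearMap.range_eq_top.mpr (syntacticMk_surjective S))
  have hg : ∀ p, functional S (r (syntacticMk S p)) = functional S p := by
    intro p
    rw [← sub_eq_zero, ← map_sub]
    refine (syntacticIdeal_isGreatest S).1 _ (syntacticMk_eq_zero.mp ?_)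
    have := LinearMap.congr_fun hr (syntacticMk S p)
    simp only [LinearMap.comp_apply, AlgHom.toLinearMap_apply, LinearMap.id_apply] at this
    rw [map_sub, this, sub_self]
  let mu : FreeMonoid X →* Matrix (Fin (Module.finrank k (SyntacticAlgebra S)))
      (Fin (Module.finrank k (SyntacticAlgebra S))) k :=
    ((Algebra.leftMulMatrix b).toMonoidHom.comp (syntacticMk S : NCPoly k X →* _)).comp
      (MonoidAlgebra.of k (FreeMonoid X))
  refine ⟨_, fun i => functional S (r (b i)), mu, b.repr 1, fun w => ?_⟩
  have hmu : (mu w).mulVec (b.repr 1) = b.repr (syntacticMk S (MonoidAlgebra.single w 1)) := by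
    simp [mu, Algebra.leftMulMatrix_mulVec_repr]
  rw [hmu]
  have h1 := hg (MonoidAlgebra.single w 1)
  rw [functional_single, one_mul, ← b.sum_repr (syntacticMk S (MonoidAlgebra.single w 1))] at h1
  rw [← h1]
  simp [dotProduct, mul_comm, -Module.Basis.sum_repr]

end Syntactic

/-! ### The algebra of formal series -/

section Cauchy

variable {k X : Type*} [Field k]

@[simp]
theorem cauchyMul_one (S T : FormalSeries k X) : cauchyMul S T 1 = S 1 * T 1 := by
  simp [cauchyMul, FreeMonoid.length]

theorem cauchyMul_of_mul (S T : FormalSeries k X) (a : X) (w : FreeMonoid X) :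
    cauchyMul S T (FreeMonoid.of a * w) =
      cauchyMul (leftQuot a S) T w + S 1 * T (FreeMonoid.of a * w) := by
  simp only [cauchyMul, FreeMonoid.length_mul, FreeMonoid.length_of, add_comm 1,
    Finset.sum_range_succ' _ (w.length + 1)]
  simp [FreeMonoid.ofList_cons]

theorem leftQuot_cauchyMul (S T : FormalSeries k X) (a : X) :
    leftQuot a (cauchyMul S T) = cauchyMul (leftQuot a S) T + S 1 • leftQuot a T :=
  funext fun w => cauchyMul_of_mul S T a w

theorem cauchyMul_congr (S : FormalSeries k X) {T T' : FormalSeries k X} {w : FreeMonoid X}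
    (h : ∀ v : FreeMonoid X, v.length ≤ w.length → T v = T' v) :
    cauchyMul S T w = cauchyMul S T' w := by
  refine Finset.sum_congr rfl fun i _ => ?_
  rw [h]
  simp [FreeMonoid.length]

theorem add_cauchyMul (S S' T : FormalSeries k X) :
    cauchyMul (S + S') T = cauchyMul S T + cauchyMul S' T := by
  funext w
  simp [cauchyMul, add_mul, Finset.sum_add_distrib]

theorem cauchyMul_add (S T T' : FormalSeries k X) :
    cauchyMul S (T + T') = cauchyMul S T + cauchyMul S T' := by
  funext w
  simp [cauchyMul, mul_add, Finset.sum_add_distrib]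

theorem smul_cauchyMul (c : k) (S T : FormalSeries k X) :
    cauchyMul (c • S) T = c • cauchyMul S T := by
  funext w
  simp [cauchyMul, Finset.mul_sum, mul_assoc]

@[simp]
theorem cauchyMul_zero (S : FormalSeries k X) : cauchyMul S 0 = 0 := by
  funext w
  simp [cauchyMul]

@[simp]
theorem zero_cauchyMul (S : FormalSeries k X) : cauchyMul 0 S = 0 := by
  funext w
  simp [cauchyMul]

theorem cauchyMul_sum {ι : Type*} (s : Finset ι) (S : FormalSeries k X)
    (T : ι → FormalSeries k X) : cauchyMul S (∑ i ∈ s, T i) = ∑ i ∈ s, cauchyMul S (T i) := by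
  classical
  induction s using Finset.induction_on with
  | empty => simp
  | insert i s hi ih => rw [Finset.sum_insert hi, Finset.sum_insert hi, cauchyMul_add, ih]

@[simp]
theorem unit_one : (unit : FormalSeries k X) 1 = 1 := by simp [unit]

@[simp]
theorem leftQuot_unit (a : X) : leftQuot a (unit : FormalSeries k X) = 0 := by
  funext w
  simp [unit]

@[simp]
theorem unit_cauchyMul (S : FormalSeries k X) : cauchyMul unit S = S := by
  refine ext_word (by simp) fun a w _ => ?_
  simp [cauchyMul_of_mul]

theorem cauchyMul_assoc (S T U : FormalSeries k X) :
    cauchyMul (cauchyMul S T) U = cauchyMul S (cauchyMul T U) := by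
  funext w
  induction w using FreeMonoid.inductionOn' generalizing S T U with
  | one => simp [mul_assoc]
  | of_mul a w ih =>
    rw [cauchyMul_of_mul, cauchyMul_of_mul, cauchyMul_of_mul, leftQuot_cauchyMul, add_cauchyMul,
      smul_cauchyMul, cauchyMul_one, Pi.add_apply, Pi.smul_apply, ih, smul_eq_mul]
    ring

theorem kleeneStar_eq_sum {S : FormalSeries k X} (hS : IsProper S) {w : FreeMonoid X} {N : ℕ}
    (hN : w.length ≤ N) : kleeneStar S w = ∑ n ∈ Finset.range (N + 1), cauchyPow S n w := by
  refine Finset.sum_subset (by simpa using hN) fun n _ hn => cauchyPow_eq_zero hS n w ?_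
  simp at hn
  omega

@[simp]
theorem kleeneStar_one (S : FormalSeries k X) : kleeneStar S 1 = 1 := by
  simp [kleeneStar, cauchyPow]

/-- The identity `a⁻¹ S^* = (a⁻¹ S) S^*`, which is the equation `S^* = 1 + S S^*` at the nonempty
words. -/
theorem leftQuot_kleeneStar {S : FormalSeries k X} (hS : IsProper S) (a : X) :
    leftQuot a (kleeneStar S) = cauchyMul (leftQuot a S) (kleeneStar S) := by
  funext w
  have h0 : S 1 = 0 := hS
  have h1 : cauchyMul (leftQuot a S) (kleeneStar S) w =
      cauchyMul (leftQuot a S) (∑ n ∈ Finset.range (w.length + 1), cauchyPow S n) w :=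
    cauchyMul_congr _ fun v hv => by rw [kleeneStar_eq_sum hS hv, Finset.sum_apply]
  rw [h1, cauchyMul_sum, Finset.sum_apply, leftQuot_apply, kleeneStar, FreeMonoid.length_mul,
    FreeMonoid.length_of, add_comm 1, Finset.sum_range_succ']
  simp [cauchyPow, cauchyMul_of_mul, h0, unit]

/-- Arden's lemma: for proper `M` the equation `x = c + M x` has at most the solution `M^* c`. -/
theorem eq_kleeneStar_cauchyMul {M c x : FormalSeries k X} (hM : IsProper M)
    (hx : x = c + cauchyMul M x) : x = cauchyMul (kleeneStar M) c := by
  have hM0 : M 1 = 0 := hM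
  suffices H : ∀ n, ∀ w : FreeMonoid X, w.length ≤ n → x w = cauchyMul (kleeneStar M) c w from
    funext fun w => H _ w le_rfl
  intro n
  induction n with
  | zero =>
    intro w hw
    obtain rfl : w = 1 := FreeMonoid.length_eq_zero.mp (by omega)
    rw [hx]
    simp [hM0]
  | succ n ih =>
    intro w hw
    induction w using FreeMonoid.casesOn with
    | one => exact ih 1 (by simp)
    | of_mul a w =>
      rw [FreeMonoid.length_mul, FreeMonoid.length_of] at hw
      rw [hx, Pi.add_apply, cauchyMul_of_mul, cauchyMul_of_mul, leftQuot_kleeneStar hM,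
        cauchyMul_assoc, cauchyMul_congr (T' := cauchyMul (kleeneStar M) c) _
          fun v hv => ih v (by omega)]
      simp [hM0, add_comm]

end Cauchy

/-! ### Rational series are recognisable -/

section RationalToRecognisable

variable {k X : Type*} [Field k]

namespace HasFiniteRankQuotients

variable {S T : FormalSeries k X}

theorem zero : HasFiniteRankQuotients (0 : FreeMonoid X → k) :=
  ⟨⊥, Submodule.fg_bot, Submodule.zero_mem _, by
    rintro a f hf
    rw [Submodule.mem_bot] at hf ⊢
    rw [hf]
    rfl⟩

theorem of_leftQuot (V : Submodule k (FreeMonoid X → k)) (hV : V.FG)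
    (hVq : ∀ a, ∀ f ∈ V, leftQuot a f ∈ V) (h : ∀ a, leftQuot a S ∈ V) :
    HasFiniteRankQuotients S := by
  refine ⟨V ⊔ k ∙ S, hV.sup (Submodule.fg_span_singleton S),
    Submodule.mem_sup_right (Submodule.mem_span_singleton_self S), fun a f hf => ?_⟩
  obtain ⟨g, hg, s, hs, rfl⟩ := Submodule.mem_sup.mp hf
  obtain ⟨c, rfl⟩ := Submodule.mem_span_singleton.mp hs
  exact Submodule.mem_sup_left (V.add_mem (hVq a g hg) (V.smul_mem c (h a)))

open scoped Classical in
theorem single (w : FreeMonoid X) (c : k) :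
    HasFiniteRankQuotients (Pi.single w c : FreeMonoid X → k) := by
  induction w using FreeMonoid.inductionOn' with
  | one =>
    refine of_leftQuot ⊥ Submodule.fg_bot (fun a f hf => ?_) fun a => ?_
    · rw [Submodule.mem_bot] at hf ⊢
      rw [hf]
      rfl
    rw [Submodule.mem_bot]
    funext u
    simp
  | of_mul b w ih =>
    obtain ⟨V, hV, hwV, hVq⟩ := ih
    refine of_leftQuot V hV hVq fun a => ?_
    by_cases hab : a = b
    · subst hab
      convert hwV using 1
      funext u
      simp [Pi.single_apply]
    · convert V.zero_mem using 1
      funext u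
      have : FreeMonoid.of a * u ≠ FreeMonoid.of b * w := fun h =>
        hab (List.cons.inj (congrArg FreeMonoid.toList h)).1
      simp [this]

theorem of_finite_support (hS : (Function.support S).Finite) : HasFiniteRankQuotients S := by
  classical
  have h : S = ∑ w ∈ hS.toFinset, Pi.single w (S w) := by
    funext u
    by_cases hu : S u = 0 <;> simp [Finset.sum_apply, Pi.single_apply, hu]
  rw [h]
  exact Finset.sum_induction _ HasFiniteRankQuotients (fun _ _ => add) zero
    fun w _ => single w (S w)

/-- Right multiplication by a series with respect to the Cauchy product. -/
def cauchyMulRight (T : FormalSeries k X) : FormalSeries k X →ₗ[k] FormalSeries k X where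
  toFun S := cauchyMul S T
  map_add' S S' := add_cauchyMul S S' T
  map_smul' c S := smul_cauchyMul c S T

theorem cauchyMul (hS : HasFiniteRankQuotients S) (hT : HasFiniteRankQuotients T) :
    HasFiniteRankQuotients (NCSeries.cauchyMul S T) := by
  obtain ⟨V, hV, hSV, hVq⟩ := hS
  obtain ⟨W, hW, hTW, hWq⟩ := hT
  refine ⟨V.map (cauchyMulRight T) ⊔ W, (hV.map _).sup hW,
    Submodule.mem_sup_left ⟨S, hSV, rfl⟩, fun a f hf => ?_⟩
  obtain ⟨_, ⟨g, hg, rfl⟩, h, hh, rfl⟩ := Submodule.mem_sup.mp hf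
  have : leftQuot a (cauchyMulRight T g + h) =
      cauchyMulRight T (leftQuot a g) + (g 1 • leftQuot a T + leftQuot a h) := by
    rw [← add_assoc]
    exact congrArg (· + leftQuot a h) (leftQuot_cauchyMul g T a)
  rw [this]
  exact Submodule.add_mem_sup ⟨_, hVq a g hg, rfl⟩
    (W.add_mem (W.smul_mem _ (hWq a T hTW)) (hWq a h hh))

theorem kleeneStar (hS : HasFiniteRankQuotients S) (hp : IsProper S) :
    HasFiniteRankQuotients (NCSeries.kleeneStar S) := by
  obtain ⟨V, hV, hSV, hVq⟩ := hS
  refine of_leftQuot (V.map (cauchyMulRight (NCSeries.kleeneStar S))) (hV.map _) ?_ fun a => ?_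
  · rintro a _ ⟨g, hg, rfl⟩
    refine ⟨leftQuot a g + g 1 • leftQuot a S,
      V.add_mem (hVq a g hg) (V.smul_mem _ (hVq a S hSV)), ?_⟩
    rw [map_add, map_smul]
    simp only [cauchyMulRight, LinearMap.coe_mk, AddHom.coe_mk]
    rw [leftQuot_cauchyMul, leftQuot_kleeneStar hp]
  · rw [leftQuot_kleeneStar hp]
    exact ⟨_, hVq a S hSV, rfl⟩

end HasFiniteRankQuotients

theorem IsRational.hasFiniteRankQuotients {S : FormalSeries k X} (h : IsRational S) :
    HasFiniteRankQuotients S := by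
  induction h with
  | polynomial S h => exact .of_finite_support h
  | add _ _ ihS ihT => exact ihS.add ihT
  | smul c _ ih => exact ih.smul c
  | mul _ _ ihS ihT => exact ihS.cauchyMul ihT
  | star _ hp ih => exact ih.kleeneStar hp

end RationalToRecognisable

/-! ### Recognisable series are rational -/

section RecognisableToRational

variable {k X : Type*} [Field k]

theorem IsRational.sum {ι : Type*} (s : Finset ι) {S : ι → FormalSeries k X}
    (h : ∀ i ∈ s, IsRational (S i)) : IsRational (∑ i ∈ s, S i) :=
  Finset.sum_induction _ IsRational (fun _ _ => IsRational.add)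
    (.polynomial 0 (by simp)) h

/-- The solutions of a proper linear system with rational coefficients are rational. By Arden's
lemma the first equation can be solved for the first unknown, which leaves a smaller system. -/
theorem isRational_of_linear_system {n : ℕ} (M : Fin n → Fin n → FormalSeries k X)
    (c x : Fin n → FormalSeries k X) (hM : ∀ i j, IsRational (M i j))
    (hp : ∀ i j, IsProper (M i j)) (hc : ∀ i, IsRational (c i))
    (hx : ∀ i, x i = c i + ∑ j, cauchyMul (M i j) (x j)) (i : Fin n) : IsRational (x i) := by
  induction n with
  | zero => exact i.elim0
  | succ n ih =>
    have hstar : IsRational (kleeneStar (M 0 0)) := .star (hM 0 0) (hp 0 0)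
    have hx0 : x 0 = cauchyMul (kleeneStar (M 0 0))
        (c 0 + ∑ j : Fin n, cauchyMul (M 0 j.succ) (x j.succ)) := by
      refine eq_kleeneStar_cauchyMul (hp 0 0) ?_
      conv_lhs => rw [hx 0, Fin.sum_univ_succ]
      abel
    have hsucc : ∀ i : Fin n, IsRational (x i.succ) := by
      refine ih
        (fun i j => M i.succ j.succ +
          cauchyMul (M i.succ 0) (cauchyMul (kleeneStar (M 0 0)) (M 0 j.succ)))
        (fun i => c i.succ + cauchyMul (M i.succ 0) (cauchyMul (kleeneStar (M 0 0)) (c 0)))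
        (fun i => x i.succ) (fun i j => .add (hM _ _) (.mul (hM _ _) (.mul hstar (hM _ _))))
        (fun i j => ?_) (fun i => .add (hc _) (.mul (hM _ _) (.mul hstar (hc _)))) fun i => ?_
      · have h1 : M i.succ j.succ 1 = 0 := hp _ _
        have h2 : M i.succ 0 1 = 0 := hp _ _
        simp [IsProper, h1, h2]
      · simp only [add_cauchyMul, Finset.sum_add_distrib, cauchyMul_assoc]
        conv_lhs => rw [hx i.succ, Fin.sum_univ_succ, hx0]
        simp only [cauchyMul_add, cauchyMul_sum]
        abel
    refine Fin.cases ?_ hsucc i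
    rw [hx0]
    exact .mul hstar (.add (hc 0) (.sum _ fun j _ => .mul (hM _ _) (hsucc j)))

/-- The series `w ↦ (μ(w) γ) i` solve a proper linear system with polynomial coefficients. -/
theorem IsRecognisable.isRational [Finite X] {S : FormalSeries k X} (h : IsRecognisable S) :
    IsRational S := by
  obtain ⟨n, lam, mu, gam, h⟩ := h
  let x : Fin n → FormalSeries k X := fun i w => (mu w).mulVec gam i
  let M : Fin n → Fin n → FormalSeries k X := fun i j w => if w.length = 1 then mu w i j else 0
  have hunit : IsRational (unit : FormalSeries k X) := by
    refine .polynomial _ ((Set.finite_singleton 1).subset fun w hw => ?_)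
    by_contra hne
    exact hw (if_neg fun h => hne (FreeMonoid.length_eq_zero.mp h))
  have hM : ∀ i j, IsRational (M i j) := fun i j => by
    refine .polynomial _ ((Set.finite_range FreeMonoid.of).subset fun w hw => ?_)
    by_contra hne
    refine hw (if_neg fun h => hne ?_)
    obtain ⟨a, rfl⟩ := FreeMonoid.length_eq_one.mp h
    exact ⟨a, rfl⟩
  have hMq : ∀ i j a, leftQuot a (M i j) = mu (FreeMonoid.of a) i j • unit := by
    intro i j a
    funext w
    by_cases hw : w = 1
    · simp [M, hw]
    · have : w.length ≠ 0 := fun h => hw (FreeMonoid.length_eq_zero.mp h)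
      simp [M, unit, hw]
  have hx : ∀ i, x i = gam i • unit + ∑ j, cauchyMul (M i j) (x j) := by
    intro i
    refine ext_word ?_ fun a w _ => ?_
    · simp [x, M]
    · have h0 : (unit : FormalSeries k X) (FreeMonoid.of a * w) = 0 :=
        congrFun (leftQuot_unit a) w
      have h1 : ∀ j, M i j 1 = 0 := fun j => by simp [M]
      simp only [Pi.add_apply, Pi.smul_apply, Finset.sum_apply, cauchyMul_of_mul, hMq,
        smul_cauchyMul, unit_cauchyMul, h0, h1]
      simp only [x, map_mul, ← Matrix.mulVec_mulVec]
      simp [Matrix.mulVec, dotProduct]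
  have hS : S = ∑ i, lam i • x i := by
    funext w
    simp [h w, dotProduct, x]
  rw [hS]
  refine .sum _ fun i _ => .smul _ (isRational_of_linear_system M (fun i => gam i • unit) x hM
    (fun i j => ?_) (fun i => .smul _ hunit) hx i)
  simp [IsProper, M]

end RecognisableToRational

/-! ### Quantification over positions and over sets of positions -/

section Markings

variable {k A B R : Type*}

/-- The word with letters `s 0, …, s (N - 1)`. -/
def word {N : ℕ} (s : Fin N → A) : FreeMonoid A := FreeMonoid.ofList (List.ofFn s)

@[simp]
theorem word_zero (s : Fin 0 → A) : word s = 1 := rfl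

theorem word_succ {N : ℕ} (s : Fin (N + 1) → A) :
    word s = FreeMonoid.of (s 0) * word fun i => s i.succ := by
  rw [word, List.ofFn_succ]
  rfl

theorem map_word (e : A → B) {N : ℕ} (s : Fin N → A) :
    FreeMonoid.map e (word s) = word fun i => e (s i) := by
  rw [word, ← FreeMonoid.ofList_map, List.map_ofFn]
  rfl

theorem word_get (w : FreeMonoid A) : word w.toList.get = w := by
  rw [word, List.ofFn_get, FreeMonoid.ofList_toList]

/-- The word over `A × Bool` in which no position is marked. -/
def unmarked : FreeMonoid A →* FreeMonoid (A × Bool) := FreeMonoid.map fun a => (a, false)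

/-- Sets of positions as markings of the positions. -/
def markingEquiv (ι : Type*) [Fintype ι] [DecidableEq ι] : Finset ι ≃ (ι → Bool) where
  toFun P i := decide (i ∈ P)
  invFun b := Finset.univ.filter fun i => b i = true
  left_inv P := by ext; simp
  right_inv b := by funext; simp

theorem sum_fun_succ [AddCommMonoid R] {C : Type*} [Fintype C] {N : ℕ}
    (F : (Fin (N + 1) → C) → R) :
    ∑ b, F b = ∑ c, ∑ b : Fin N → C, F (Fin.cons c b) := by
  rw [← (Fin.consEquiv fun _ : Fin (N + 1) => C).sum_comp, Fintype.sum_prod_type]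
  rfl

section Sums

variable [Field k]

/-- The recursion for `sumMarkings`. -/
def sumMarkingsAux : List A → (FreeMonoid (A × Bool) → k) → k
  | [], T => T 1
  | a :: u, T => ∑ b, sumMarkingsAux u (leftQuot (a, b) T)

/-- The series whose value at `u` is the sum of `T` over all markings of the positions of `u`. -/
def sumMarkings : (FreeMonoid (A × Bool) → k) →ₗ[k] (FreeMonoid A → k) where
  toFun T u := sumMarkingsAux u.toList T
  map_add' T T' := by
    funext u
    induction u using FreeMonoid.inductionOn' generalizing T T' with
    | one => rfl
    | of_mul a u ih =>
      simp only [Pi.add_apply, FreeMonoid.toList_of_mul, sumMarkingsAux] at ih ⊢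
      rw [← Finset.sum_add_distrib]
      exact Finset.sum_congr rfl fun b _ => ih _ _
  map_smul' c T := by
    funext u
    induction u using FreeMonoid.inductionOn' generalizing T with
    | one => rfl
    | of_mul a u ih =>
      simp only [Pi.smul_apply, FreeMonoid.toList_of_mul, sumMarkingsAux] at ih ⊢
      rw [Finset.smul_sum]
      exact Finset.sum_congr rfl fun b _ => ih _

theorem leftQuot_sumMarkings (a : A) (T : FreeMonoid (A × Bool) → k) :
    leftQuot a (sumMarkings T) = ∑ b, sumMarkings (leftQuot (a, b) T) := by
  funext u
  rw [Finset.sum_apply]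
  rfl

theorem sumMarkings_word (T : FreeMonoid (A × Bool) → k) {N : ℕ} (s : Fin N → A) :
    sumMarkings T (word s) = ∑ b : Fin N → Bool, T (word fun i => (s i, b i)) := by
  induction N generalizing T with
  | zero => simp [sumMarkings, sumMarkingsAux]
  | succ N ih =>
    rw [word_succ]
    change leftQuot (s 0) (sumMarkings T) _ = _
    rw [leftQuot_sumMarkings, Finset.sum_apply, sum_fun_succ]
    refine Finset.sum_congr rfl fun c _ => ?_
    rw [ih]
    refine Finset.sum_congr rfl fun b _ => ?_
    simp [word_succ fun i => (s i, Fin.cons (α := fun _ => Bool) c b i)]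

theorem HasFiniteRankQuotients.sumMarkings {T : FreeMonoid (A × Bool) → k}
    (hT : HasFiniteRankQuotients T) : HasFiniteRankQuotients (sumMarkings T) := by
  obtain ⟨V, hV, hTV, hVq⟩ := hT
  refine ⟨V.map NCSeries.sumMarkings, hV.map _, ⟨T, hTV, rfl⟩, ?_⟩
  rintro a _ ⟨f, hf, rfl⟩
  rw [leftQuot_sumMarkings]
  exact Submodule.sum_mem _ fun b _ => ⟨_, hVq _ f hf, rfl⟩

/-- The recursion for `sumPositions`. -/
def sumPositionsAux : List A → (FreeMonoid (A × Bool) → k) → k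
  | [], _ => 0
  | a :: u, T => leftQuot (a, true) T (unmarked (FreeMonoid.ofList u)) +
      sumPositionsAux u (leftQuot (a, false) T)

/-- The series whose value at `u` is the sum of `T` over all markings of a single position. -/
def sumPositions : (FreeMonoid (A × Bool) → k) →ₗ[k] (FreeMonoid A → k) where
  toFun T u := sumPositionsAux u.toList T
  map_add' T T' := by
    funext u
    induction u using FreeMonoid.inductionOn' generalizing T T' with
    | one => exact (add_zero 0).symm
    | of_mul a u ih =>
      simp only [Pi.add_apply, FreeMonoid.toList_of_mul, sumPositionsAux] at ih ⊢
      refine (congrArg _ (ih (leftQuot (a, false) T) (leftQuot (a, false) T'))).trans ?_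
      exact add_add_add_comm _ _ _ _
  map_smul' c T := by
    funext u
    induction u using FreeMonoid.inductionOn' generalizing T with
    | one => exact (smul_zero c).symm
    | of_mul a u ih =>
      simp only [Pi.smul_apply, FreeMonoid.toList_of_mul, sumPositionsAux] at ih ⊢
      refine (congrArg _ (ih (leftQuot (a, false) T))).trans ?_
      exact (smul_add c _ _).symm

theorem leftQuot_sumPositions (a : A) (T : FreeMonoid (A × Bool) → k) :
    leftQuot a (sumPositions T) =
      LinearMap.funLeft k k unmarked (leftQuot (a, true) T) +
        sumPositions (leftQuot (a, false) T) := rfl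

theorem word_mark_zero {N : ℕ} (s : Fin (N + 1) → A) :
    (word fun j => (s j, decide (0 = j))) =
      FreeMonoid.of (s 0, true) * unmarked (word fun j => s j.succ) := by
  rw [word_succ, unmarked, map_word]
  simp [(Fin.succ_ne_zero _).symm]

theorem word_mark_succ {N : ℕ} (s : Fin (N + 1) → A) (i : Fin N) :
    (word fun j => (s j, decide (i.succ = j))) =
      FreeMonoid.of (s 0, false) * word fun j => (s j.succ, decide (i = j)) := by
  rw [word_succ]
  simp

theorem sumPositions_word (T : FreeMonoid (A × Bool) → k) {N : ℕ} (s : Fin N → A) :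
    sumPositions T (word s) = ∑ i : Fin N, T (word fun j => (s j, decide (i = j))) := by
  induction N generalizing T with
  | zero => simp [sumPositions, sumPositionsAux]
  | succ N ih =>
    rw [word_succ]
    change leftQuot (s 0) (sumPositions T) _ = _
    rw [leftQuot_sumPositions, Pi.add_apply, ih, Fin.sum_univ_succ,
      word_mark_zero]
    simp only [word_mark_succ]
    rfl

theorem HasFiniteRankQuotients.sumPositions {T : FreeMonoid (A × Bool) → k}
    (hT : HasFiniteRankQuotients T) : HasFiniteRankQuotients (sumPositions T) := by
  obtain ⟨V, hV, hTV, hVq⟩ := hT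
  refine ⟨V.map (LinearMap.funLeft k k unmarked) ⊔ V.map NCSeries.sumPositions,
    (hV.map _).sup (hV.map _), Submodule.mem_sup_right ⟨T, hTV, rfl⟩, fun a f hf => ?_⟩
  obtain ⟨_, ⟨g, hg, rfl⟩, _, ⟨h, hh, rfl⟩, rfl⟩ := Submodule.mem_sup.mp hf
  have : leftQuot a (LinearMap.funLeft k k unmarked g + NCSeries.sumPositions h) =
      LinearMap.funLeft k k unmarked (leftQuot (a, false) g + leftQuot (a, true) h) +
        NCSeries.sumPositions (leftQuot (a, false) h) := by
    rw [map_add, add_assoc, ← leftQuot_sumPositions]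
    rfl
  rw [this]
  exact Submodule.add_mem_sup ⟨_, V.add_mem (hVq _ g hg) (hVq _ h hh), rfl⟩
    ⟨_, hVq _ h hh, rfl⟩

/-- The recursion for `prodPositions`. -/
def prodPositionsAux : List A → (FreeMonoid (A × Bool) → k) → k
  | [], _ => 1
  | a :: u, f => leftQuot (a, true) f (unmarked (FreeMonoid.ofList u)) *
      prodPositionsAux u (leftQuot (a, false) f)

/-- The series whose value at `u` is the product of `f` over all markings of a single position. -/
def prodPositions (f : FreeMonoid (A × Bool) → k) : FreeMonoid A → k :=
  fun u => prodPositionsAux u.toList f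

theorem leftQuot_prodPositions (a : A) (f : FreeMonoid (A × Bool) → k) :
    leftQuot a (prodPositions f) =
      (fun u => leftQuot (a, true) f (unmarked u)) * prodPositions (leftQuot (a, false) f) := rfl

theorem prodPositions_word (f : FreeMonoid (A × Bool) → k) {N : ℕ} (s : Fin N → A) :
    prodPositions f (word s) = ∏ i : Fin N, f (word fun j => (s j, decide (i = j))) := by
  induction N generalizing f with
  | zero => simp [prodPositions, prodPositionsAux]
  | succ N ih =>
    rw [word_succ]
    change leftQuot (s 0) (prodPositions f) _ = _
    rw [leftQuot_prodPositions, Pi.mul_apply, ih, Fin.prod_univ_succ,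
      word_mark_zero]
    simp only [word_mark_succ]
    rfl

/-- Let `Q` be the finite set of quotients of `f`. The value of `κ u = (g ↦ g (unmarked u))` in
`Q → k` takes finitely many values, so that the functions of `κ u` form a finite-dimensional
algebra `C`. Splitting off the first letter turns `prodPositions h` into an element of `C` times
`prodPositions h'`; hence `C` and the `prodPositions h`, `h ∈ Q`, generate a space of finite
dimension that is stable under left quotients. -/
theorem HasFinitelyManyQuotients.prodPositions {f : FreeMonoid (A × Bool) → k}
    (hf : HasFinitelyManyQuotients f) : HasFiniteRankQuotients (prodPositions f) := by
  obtain ⟨Q, hQ, hfQ, hq⟩ := hf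
  have : Finite Q := hQ
  let κ : FreeMonoid A → Q → k := fun u g => g.1 (unmarked u)
  have hval : ∀ v, ∀ g ∈ Q, g v ∈ (fun h : FreeMonoid (A × Bool) → k => h 1) '' Q := by
    intro v
    induction v using FreeMonoid.inductionOn' with
    | one => exact fun g hg => ⟨g, hg, rfl⟩
    | of_mul a v ih => exact fun g hg => ih _ (hq a g hg)
  have hκ : (Set.range κ).Finite := by
    refine (Set.Finite.pi' fun _ : Q => hQ.image fun h => h 1).subset ?_
    rintro _ ⟨u, rfl⟩ g
    exact hval _ g.1 g.2
  have hκq : ∀ a u v, κ u = κ v → κ (FreeMonoid.of a * u) = κ (FreeMonoid.of a * v) :=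
    fun a u v h => funext fun g => congrFun h ⟨leftQuot (a, false) g.1, hq _ _ g.2⟩
  let C : Submodule k (FreeMonoid A → k) :=
    { carrier := {F | ∀ u v, κ u = κ v → F u = F v}
      add_mem' := fun hF hG u v h => congrArg₂ (· + ·) (hF u v h) (hG u v h)
      zero_mem' := fun _ _ _ => rfl
      smul_mem' := fun c F hF u v h => congrArg (c • ·) (hF u v h) }
  have hC : C.FG := by
    have : Finite (Set.range κ) := hκ
    have hle : C ≤ LinearMap.range (LinearMap.funLeft k k (Set.rangeFactorization κ)) := by
      intro F hF
      refine ⟨fun z => F z.2.choose, funext fun u => hF _ _ ?_⟩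
      exact (Set.rangeFactorization κ u).2.choose_spec
    have : Module.Finite k C := Submodule.finiteDimensional_of_le hle
    exact Module.Finite.iff_fg.mp this
  have hCC : C * C ≤ C := Submodule.mul_le.mpr fun F hF G hG u v h =>
    congrArg₂ (· * ·) (hF u v h) (hG u v h)
  let D : Submodule k (FreeMonoid A → k) := Submodule.span k (NCSeries.prodPositions '' Q)
  have hCD : ∀ F ∈ C, ∀ G ∈ C * D, F * G ∈ C * D := by
    intro F hF G hG
    have := Submodule.mul_mem_mul hF hG
    rw [← mul_assoc] at this
    exact mul_le_mul_left hCC D this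
  have hD : ∀ a, ∀ d ∈ D, leftQuot a d ∈ C * D := by
    intro a d hd
    induction hd using Submodule.span_induction with
    | mem d hd =>
      obtain ⟨h, hh, rfl⟩ := hd
      rw [leftQuot_prodPositions]
      refine Submodule.mul_mem_mul (fun u v huv => ?_)
        (Submodule.subset_span ⟨_, hq _ _ hh, rfl⟩)
      exact congrFun huv ⟨_, hq _ _ hh⟩
    | zero => exact Submodule.zero_mem _
    | add g h _ _ ihg ihh => exact Submodule.add_mem _ ihg ihh
    | smul c g _ ih => exact Submodule.smul_mem _ c ih
  refine ⟨C * D, hC.mul (Submodule.fg_span (hQ.image _)), ?_, fun a F hF => ?_⟩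
  · rw [← one_mul (NCSeries.prodPositions f)]
    exact Submodule.mul_mem_mul (fun _ _ _ => rfl) (Submodule.subset_span ⟨f, hfQ, rfl⟩)
  · induction hF using Submodule.mul_induction_on' with
    | mem_mul_mem c hc d hd =>
      exact hCD (leftQuot a c) (fun u v h => hc _ _ (hκq a u v h)) _ (hD a d hd)
    | add g _ h _ ihg ihh => exact (C * D).add_mem ihg ihh

end Sums

/-! ### Regular languages -/

/-- The recursion for `allMarkings`. -/
def allMarkingsAux : List A → (FreeMonoid (A × Bool) → Prop) → Prop
  | [], L => L 1
  | a :: u, L => ∀ b, allMarkingsAux u (leftQuot (a, b) L)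

/-- The words `u` all of whose markings lie in `L`. -/
def allMarkings (L : FreeMonoid (A × Bool) → Prop) : FreeMonoid A → Prop :=
  fun u => allMarkingsAux u.toList L

theorem allMarkings_word (L : FreeMonoid (A × Bool) → Prop) {N : ℕ} (s : Fin N → A) :
    allMarkings L (word s) ↔ ∀ b : Fin N → Bool, L (word fun i => (s i, b i)) := by
  induction N generalizing L with
  | zero => simp [allMarkings, allMarkingsAux]
  | succ N ih =>
    have h1 : allMarkings L (word s) ↔
        ∀ c, allMarkings (leftQuot (s 0, c) L) (word fun i => s i.succ) := by
      rw [word_succ]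
      rfl
    rw [h1, Fin.forall_fin_succ_pi]
    refine forall_congr' fun c => ?_
    rw [ih]
    refine forall_congr' fun b => ?_
    simp [word_succ fun i => (s i, Fin.cons (α := fun _ => Bool) c b i)]

/-- The subset construction. -/
theorem HasFinitelyManyQuotients.allMarkings {L : FreeMonoid (A × Bool) → Prop}
    (hL : HasFinitelyManyQuotients L) : HasFinitelyManyQuotients (allMarkings L) := by
  obtain ⟨Q, hQ, hLQ, hq⟩ := hL
  refine ⟨(fun P u => ∀ g ∈ P, NCSeries.allMarkings g u) '' Q.powerset, hQ.finite_subsets.image _,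
    ⟨{L}, by simpa using hLQ, by simp⟩, ?_⟩
  rintro a _ ⟨P, hP, rfl⟩
  refine ⟨{h | ∃ g ∈ P, ∃ b, h = leftQuot (a, b) g}, ?_, funext fun u => propext ?_⟩
  · rintro _ ⟨g, hg, b, rfl⟩
    exact hq _ _ (hP hg)
  · constructor
    · exact fun H g hg b => H _ ⟨g, hg, b, rfl⟩
    · rintro H _ ⟨g, hg, b, rfl⟩
      exact H g hg b

/-- The recursion for `allPositions`. -/
def allPositionsAux : List A → (FreeMonoid (A × Bool) → Prop) → Prop
  | [], _ => True
  | a :: u, L => leftQuot (a, true) L (unmarked (FreeMonoid.ofList u)) ∧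
      allPositionsAux u (leftQuot (a, false) L)

/-- The words `u` all of whose markings of a single position lie in `L`. -/
def allPositions (L : FreeMonoid (A × Bool) → Prop) : FreeMonoid A → Prop :=
  fun u => allPositionsAux u.toList L

theorem allPositions_word (L : FreeMonoid (A × Bool) → Prop) {N : ℕ} (s : Fin N → A) :
    allPositions L (word s) ↔ ∀ i : Fin N, L (word fun j => (s j, decide (i = j))) := by
  induction N generalizing L with
  | zero => simp [allPositions, allPositionsAux]
  | succ N ih =>
    have h1 : allPositions L (word s) ↔
        leftQuot (s 0, true) L (unmarked (word fun i => s i.succ)) ∧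
          allPositions (leftQuot (s 0, false) L) (word fun i => s i.succ) := by
      rw [word_succ]
      rfl
    rw [h1, Fin.forall_fin_succ, word_mark_zero, ih]
    simp only [word_mark_succ]
    rfl

theorem HasFinitelyManyQuotients.allPositions {L : FreeMonoid (A × Bool) → Prop}
    (hL : HasFinitelyManyQuotients L) : HasFinitelyManyQuotients (allPositions L) := by
  obtain ⟨Q, hQ, hLQ, hq⟩ := hL
  refine ⟨Set.image2 (fun P h u => (∀ g ∈ P, g (unmarked u)) ∧ NCSeries.allPositions h u)
    Q.powerset Q, hQ.finite_subsets.image2 _ hQ, ⟨∅, by simp, L, hLQ, by simp⟩, ?_⟩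
  rintro a _ ⟨P, hP, h, hh, rfl⟩
  refine ⟨insert (leftQuot (a, true) h) (leftQuot (a, false) '' P), ?_,
    leftQuot (a, false) h, hq _ _ hh, funext fun u => propext ?_⟩
  · rintro _ (rfl | ⟨g, hg, rfl⟩)
    · exact hq _ _ hh
    · exact hq _ _ (hP hg)
  · simp only [Set.forall_mem_insert, Set.forall_mem_image]
    constructor
    · exact fun H => ⟨fun g hg => H.1.2 hg, H.1.1, H.2⟩
    · exact fun H => ⟨⟨H.2.1, fun g hg => H.1 g hg⟩, H.2.2⟩

theorem hasFinitelyManyQuotients_exists_mem (p : A → Prop) :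
    HasFinitelyManyQuotients fun w : FreeMonoid A => ∃ a ∈ w.toList, p a := by
  refine ⟨{fun w => ∃ a ∈ w.toList, p a, fun _ => True}, by simp, by simp, ?_⟩
  rintro a _ (rfl | rfl)
  · by_cases ha : p a
    · right
      funext w
      simp [ha]
    · left
      funext w
      simp [ha]
  · exact Or.inr rfl

theorem exists_mem_word (p : A → Prop) {N : ℕ} (s : Fin N → A) :
    (∃ a ∈ (word s).toList, p a) ↔ ∃ i, p (s i) := by
  simp [word]

/-- The words in which a letter in `p` occurs, and a letter in `q` at the same or at a later
position. -/
def existsPair (p q : A → Prop) : List A → Prop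
  | [] => False
  | a :: u => (p a ∧ (q a ∨ ∃ b ∈ u, q b)) ∨ existsPair p q u

theorem existsPair_word (p q : A → Prop) {N : ℕ} (s : Fin N → A) :
    existsPair p q (word s).toList ↔ ∃ i j, i ≤ j ∧ p (s i) ∧ q (s j) := by
  induction N with
  | zero => simp [existsPair]
  | succ N ih =>
    rw [word_succ, FreeMonoid.toList_of_mul, existsPair, ih, exists_mem_word, Fin.exists_fin_succ]
    simp [Fin.exists_fin_succ]

theorem hasFinitelyManyQuotients_existsPair (p q : A → Prop) :
    HasFinitelyManyQuotients fun w : FreeMonoid A => existsPair p q w.toList := by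
  refine ⟨{fun w => existsPair p q w.toList,
    fun w => (∃ b ∈ w.toList, q b) ∨ existsPair p q w.toList, fun _ => True},
    by simp, by simp, ?_⟩
  rintro a _ (rfl | rfl | rfl)
  · by_cases hp : p a
    · by_cases hq : q a
      · refine Or.inr (Or.inr (funext fun w => ?_))
        simp [existsPair, hp, hq]
      · refine Or.inr (Or.inl (funext fun w => ?_))
        simp [existsPair, hp, hq]
    · refine Or.inl (funext fun w => ?_)
      simp [existsPair, hp]
  · by_cases hq : q a
    · refine Or.inr (Or.inr (funext fun w => ?_))
      simp [hq]
    · refine Or.inr (Or.inl (funext fun w => ?_))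
      simp only [leftQuot_apply, FreeMonoid.toList_of_mul, existsPair, List.exists_mem_cons_iff, hq,
        false_or, eq_iff_iff]
      by_cases hp : p a <;> simp [hp]
  · exact Or.inr (Or.inr rfl)

end Markings

/-! ### Definable series are recognisable -/

section Encoding

variable {k X : Type*} {n m : ℕ}

/-- Letters with one bit for each first-order and each set variable. -/
abbrev MarkedLetter (X : Type*) (n m : ℕ) := X × (Fin n → Bool) × (Fin m → Bool)

/-- A word with an assignment, as a word over the alphabet of marked letters: at each position the
bits tell which first-order variables take this position as their value, and which set variables
contain it. -/
def encode (w : List X) (ρ : Fin n → Fin w.length) (σ : Fin m → Finset (Fin w.length)) :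
    FreeMonoid (MarkedLetter X n m) :=
  word fun i => (w.get i, fun j => decide (ρ j = i), fun j => decide (i ∈ σ j))

/-- A marking becomes the bit of a new first-order variable. -/
def consFO (p : MarkedLetter X n m × Bool) : MarkedLetter X (n + 1) m :=
  (p.1.1, Fin.cons p.2 p.1.2.1, p.1.2.2)

/-- A marking becomes the bit of a new set variable. -/
def consSO (p : MarkedLetter X n m × Bool) : MarkedLetter X n (m + 1) :=
  (p.1.1, p.1.2.1, Fin.cons p.2 p.1.2.2)

variable (w : List X) (ρ : Fin n → Fin w.length) (σ : Fin m → Finset (Fin w.length))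

theorem encode_consFO (i : Fin w.length) :
    encode w (Fin.cons i ρ) σ = FreeMonoid.map consFO (word fun j =>
      ((w.get j, fun l => decide (ρ l = j), fun l => decide (j ∈ σ l)), decide (i = j))) := by
  rw [map_word, encode]
  congr 1
  funext j
  refine Prod.ext rfl (Prod.ext (funext fun l => ?_) rfl)
  cases l using Fin.cases <;> simp [consFO]

theorem encode_consSO (P : Finset (Fin w.length)) :
    encode w ρ (Fin.cons P σ) = FreeMonoid.map consSO (word fun j =>
      ((w.get j, fun l => decide (ρ l = j), fun l => decide (j ∈ σ l)),
        markingEquiv _ P j)) := by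
  rw [map_word, encode]
  congr 1
  funext j
  refine Prod.ext rfl (Prod.ext rfl (funext fun l => ?_))
  cases l using Fin.cases <;> simp [consSO, markingEquiv]

/-- Büchi's theorem: a Boolean formula defines a regular language of encodings. Nothing is asserted
about the words over the marked alphabet that encode no assignment. -/
theorem BoolMSO.exists_hasFinitelyManyQuotients (β : BoolMSO X n m) :
    ∃ L : FreeMonoid (MarkedLetter X n m) → Prop, HasFinitelyManyQuotients L ∧
      ∀ w ρ σ, L (encode w ρ σ) ↔ β.Sat w ρ σ := by
  induction β with
  | letter a x =>
    refine ⟨_, hasFinitelyManyQuotients_exists_mem fun b => b.2.1 x = true ∧ b.1 = a,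
      fun w ρ σ => ?_⟩
    rw [encode, exists_mem_word]
    simp [BoolMSO.Sat]
  | le x y =>
    refine ⟨_, hasFinitelyManyQuotients_existsPair (fun b => b.2.1 x = true)
      (fun b => b.2.1 y = true), fun w ρ σ => ?_⟩
    rw [encode, existsPair_word]
    simp [BoolMSO.Sat]
  | mem x Y =>
    refine ⟨_, hasFinitelyManyQuotients_exists_mem fun b => b.2.1 x = true ∧ b.2.2 Y = true,
      fun w ρ σ => ?_⟩
    rw [encode, exists_mem_word]
    simp [BoolMSO.Sat]
  | not φ ih =>
    obtain ⟨L, hL, h⟩ := ih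
    exact ⟨_, hL.comp Not, fun w ρ σ => not_congr (h w ρ σ)⟩
  | and φ ψ ihφ ihψ =>
    obtain ⟨L, hL, h⟩ := ihφ
    obtain ⟨L', hL', h'⟩ := ihψ
    exact ⟨_, hL.comp₂ And hL', fun w ρ σ => and_congr (h w ρ σ) (h' w ρ σ)⟩
  | allFO φ ih =>
    obtain ⟨L, hL, h⟩ := ih
    refine ⟨_, (hL.comp_map consFO).allPositions, fun w ρ σ => ?_⟩
    rw [encode, allPositions_word]
    exact forall_congr' fun i => by rw [← encode_consFO, h]
  | allSO φ ih =>
    obtain ⟨L, hL, h⟩ := ih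
    refine ⟨_, (hL.comp_map consSO).allMarkings, fun w ρ σ => ?_⟩
    rw [encode, allMarkings_word, ← (markingEquiv (Fin w.length)).forall_congr_right]
    exact forall_congr' fun P => by rw [← encode_consSO, h]

end Encoding

namespace WMSO

variable {k X : Type*} [Field k] {n m : ℕ}

open scoped Classical in
/-- A weighted formula that is Boolean takes the values `0` and `1` of a Boolean formula. -/
theorem IsBoolean.exists_boolMSO {φ : WMSO k X n m} (hφ : φ.IsBoolean) :
    ∃ β : BoolMSO X n m, ∀ w ρ σ, φ.eval w ρ σ = if β.Sat w ρ σ then 1 else 0 := by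
  induction φ with
  | bool β => exact ⟨β, fun _ _ _ => rfl⟩
  | and φ ψ ihφ ihψ =>
    obtain ⟨β, h⟩ := ihφ hφ.1
    obtain ⟨γ, h'⟩ := ihψ hφ.2
    refine ⟨β.and γ, fun w ρ σ => ?_⟩
    simp only [eval, h, h']
    by_cases h1 : β.Sat w ρ σ <;> by_cases h2 : γ.Sat w ρ σ <;> simp [h1, h2, BoolMSO.Sat]
  | allFO φ ih =>
    obtain ⟨β, h⟩ := ih hφ
    refine ⟨β.allFO, fun w ρ σ => ?_⟩
    simp only [eval, h, Finset.prod_ite_zero, Finset.prod_const_one]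
    by_cases H : β.allFO.Sat w ρ σ
    · rw [if_pos fun i _ => H i, if_pos H]
    · rw [if_neg fun H' => H fun i => H' i (Finset.mem_univ i), if_neg H]
  | allSO φ ih =>
    obtain ⟨β, h⟩ := ih hφ
    refine ⟨β.allSO, fun w ρ σ => ?_⟩
    simp only [eval, h, Finset.prod_ite_zero, Finset.prod_const_one]
    by_cases H : β.allSO.Sat w ρ σ
    · rw [if_pos fun i _ => H i, if_pos H]
    · rw [if_neg fun H' => H fun i => H' i (Finset.mem_univ i), if_neg H]
  | const | or | exFO | exSO => exact hφ.elim

open scoped Classical in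
theorem IsBoolean.exists_hasFinitelyManyQuotients {φ : WMSO k X n m} (hφ : φ.IsBoolean) :
    ∃ f : FreeMonoid (MarkedLetter X n m) → k, HasFinitelyManyQuotients f ∧
      ∀ w ρ σ, f (encode w ρ σ) = φ.eval w ρ σ := by
  obtain ⟨β, h⟩ := hφ.exists_boolMSO
  obtain ⟨L, hL, h'⟩ := β.exists_hasFinitelyManyQuotients
  exact ⟨_, hL.comp fun p => if p then (1 : k) else 0, fun w ρ σ => by simp only [h, h']⟩

theorem IsAlmostBoolean.exists_hasFinitelyManyQuotients {φ : WMSO k X n m}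
    (hφ : φ.IsAlmostBoolean) :
    ∃ f : FreeMonoid (MarkedLetter X n m) → k, HasFinitelyManyQuotients f ∧
      ∀ w ρ σ, f (encode w ρ σ) = φ.eval w ρ σ := by
  induction hφ with
  | const c => exact ⟨_, .const c, fun _ _ _ => rfl⟩
  | boolean h => exact h.exists_hasFinitelyManyQuotients
  | or _ _ ihφ ihψ =>
    obtain ⟨f, hf, h⟩ := ihφ
    obtain ⟨g, hg, h'⟩ := ihψ
    exact ⟨_, hf.comp₂ (· + ·) hg, fun w ρ σ => by simp only [h, h', eval]⟩
  | and _ _ ihφ ihψ =>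
    obtain ⟨f, hf, h⟩ := ihφ
    obtain ⟨g, hg, h'⟩ := ihψ
    exact ⟨_, hf.comp₂ (· * ·) hg, fun w ρ σ => by simp only [h, h', eval]⟩

theorem IsRestricted.exists_hasFiniteRankQuotients {φ : WMSO k X n m} (hφ : φ.IsRestricted) :
    ∃ T : FreeMonoid (MarkedLetter X n m) → k, HasFiniteRankQuotients T ∧
      ∀ w ρ σ, T (encode w ρ σ) = φ.eval w ρ σ := by
  induction φ with
  | const c =>
    exact ⟨_, (HasFinitelyManyQuotients.const c).hasFiniteRankQuotients, fun _ _ _ => rfl⟩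
  | bool β =>
    have hβ : (bool β : WMSO k X _ _).IsBoolean := trivial
    obtain ⟨f, hf, h⟩ := hβ.exists_hasFinitelyManyQuotients
    exact ⟨f, hf.hasFiniteRankQuotients, h⟩
  | or φ ψ ihφ ihψ =>
    obtain ⟨T, hT, h⟩ := ihφ hφ.1
    obtain ⟨U, hU, h'⟩ := ihψ hφ.2
    exact ⟨_, hT.add hU, fun w ρ σ => by simp [h, h', eval]⟩
  | and φ ψ ihφ ihψ =>
    obtain ⟨T, hT, h⟩ := ihφ hφ.1
    obtain ⟨U, hU, h'⟩ := ihψ hφ.2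
    exact ⟨_, hT.mul hU, fun w ρ σ => by simp [h, h', eval]⟩
  | exFO φ ih =>
    obtain ⟨T, hT, h⟩ := ih hφ
    refine ⟨_, (hT.comp_map consFO).sumPositions, fun w ρ σ => ?_⟩
    rw [encode, sumPositions_word]
    exact Finset.sum_congr rfl fun i _ => by rw [← encode_consFO, h]
  | exSO φ ih =>
    obtain ⟨T, hT, h⟩ := ih hφ
    refine ⟨_, (hT.comp_map consSO).sumMarkings, fun w ρ σ => ?_⟩
    rw [encode, sumMarkings_word, ← (markingEquiv (Fin w.length)).sum_comp]
    exact Finset.sum_congr rfl fun P _ => by rw [← encode_consSO, h]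
  | allFO φ _ =>
    obtain ⟨f, hf, h⟩ := IsAlmostBoolean.exists_hasFinitelyManyQuotients hφ
    refine ⟨_, (hf.comp_map consFO).prodPositions, fun w ρ σ => ?_⟩
    rw [encode, prodPositions_word]
    exact Finset.prod_congr rfl fun i _ => by rw [← encode_consFO, h]
  | allSO φ _ =>
    have hβ : (allSO φ).IsBoolean := hφ
    obtain ⟨f, hf, h⟩ := hβ.exists_hasFinitelyManyQuotients
    exact ⟨f, hf.hasFiniteRankQuotients, h⟩

end WMSO

theorem IsRwMSODefinable.hasFiniteRankQuotients {k X : Type*} [Field k] {S : FormalSeries k X}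
    (h : IsRwMSODefinable S) : HasFiniteRankQuotients S := by
  obtain ⟨φ, hφ, h⟩ := h
  obtain ⟨T, hT, hT'⟩ := hφ.exists_hasFiniteRankQuotients
  convert hT.comp_map fun a : X => (a, Fin.elim0, Fin.elim0) using 1
  funext w
  rw [h, ← hT', encode]
  conv_rhs => rw [← word_get w, map_word]
  congr 1
  congr 1
  funext i
  exact Prod.ext rfl (Prod.ext (funext fun j => j.elim0) (funext fun j => j.elim0))

/-! ### Definable relations and almost Boolean functions -/

section Definability

variable {k X C D : Type*} {n m : ℕ}

/-- A quantity depending on a word and on an assignment of `n` first-order and `m` set variables. -/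
abbrev Interpretation (X : Type*) (n m : ℕ) (R : Type*) :=
  ∀ w : List X, (Fin n → Fin w.length) → (Fin m → Finset (Fin w.length)) → R

/-- The relation `R` is expressed by a Boolean MSO formula. -/
def IsDefinable (R : Interpretation X n m Prop) : Prop :=
  ∃ β : BoolMSO X n m, ∀ w ρ σ, β.Sat w ρ σ ↔ R w ρ σ

/-- The fibres of `f` are expressed by Boolean MSO formulas. -/
def HasDefinableFibres (f : Interpretation X n m C) : Prop :=
  ∀ c, IsDefinable fun w ρ σ => f w ρ σ = c

/-- The function `F` is the semantics of an almost Boolean formula. -/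
def IsAlmostBooleanDefinable [Field k] (F : Interpretation X n m k) : Prop :=
  ∃ ψ : WMSO k X n m, ψ.IsAlmostBoolean ∧ ∀ w ρ σ, ψ.eval w ρ σ = F w ρ σ

theorem IsDefinable.not {R : Interpretation X n m Prop} (h : IsDefinable R) :
    IsDefinable fun w ρ σ => ¬ R w ρ σ := by
  obtain ⟨β, h⟩ := h
  exact ⟨β.not, fun w ρ σ => not_congr (h w ρ σ)⟩

theorem IsDefinable.and {R R' : Interpretation X n m Prop} (h : IsDefinable R)
    (h' : IsDefinable R') : IsDefinable fun w ρ σ => R w ρ σ ∧ R' w ρ σ := by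
  obtain ⟨β, h⟩ := h
  obtain ⟨γ, h'⟩ := h'
  exact ⟨β.and γ, fun w ρ σ => and_congr (h w ρ σ) (h' w ρ σ)⟩

theorem isDefinable_true : IsDefinable fun (_ : List X) (_ : Fin n → _) (_ : Fin m → _) => True :=
  ⟨.allFO (.le 0 0), fun w ρ σ => by simp [BoolMSO.Sat]⟩

theorem IsDefinable.forall_fin {N : ℕ} {R : Fin N → Interpretation X n m Prop}
    (h : ∀ j, IsDefinable (R j)) : IsDefinable fun w ρ σ => ∀ j, R j w ρ σ := by
  induction N with
  | zero => simpa using isDefinable_true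
  | succ N ih => simpa only [Fin.forall_fin_succ] using (h 0).and (ih fun j => h j.succ)

theorem IsDefinable.hasDefinableFibres {R : Interpretation X n m Prop}
    [∀ w ρ σ, Decidable (R w ρ σ)] (h : IsDefinable R) :
    HasDefinableFibres fun w ρ σ => decide (R w ρ σ) := by
  rintro (_ | _)
  · simpa using h.not
  · simpa using h

theorem HasDefinableFibres.prodMk {f : Interpretation X n m C} {g : Interpretation X n m D}
    (hf : HasDefinableFibres f) (hg : HasDefinableFibres g) :
    HasDefinableFibres fun w ρ σ => (f w ρ σ, g w ρ σ) := by
  rintro ⟨c, d⟩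
  simpa only [Prod.mk.injEq] using (hf c).and (hg d)

theorem HasDefinableFibres.pi {N : ℕ} {f : Fin N → Interpretation X n m C}
    (hf : ∀ j, HasDefinableFibres (f j)) :
    HasDefinableFibres fun w ρ σ j => f j w ρ σ := by
  intro c
  simpa only [funext_iff] using IsDefinable.forall_fin fun j => hf j (c j)

open scoped Classical in
/-- A function of finitely many definable data is the sum over the possible data `c` of a constant
times the indicator function of `c`. -/
theorem HasDefinableFibres.isAlmostBooleanDefinable [Field k] [Finite C]
    {f : Interpretation X n m C} (hf : HasDefinableFibres f) (G : C → k) :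
    IsAlmostBooleanDefinable fun w ρ σ => G (f w ρ σ) := by
  have := Fintype.ofFinite C
  suffices H : ∀ s : Finset C,
      IsAlmostBooleanDefinable fun w ρ σ => ∑ c ∈ s, G c * if f w ρ σ = c then 1 else 0 by
    simpa using H Finset.univ
  intro s
  induction s using Finset.induction_on with
  | empty => exact ⟨.const 0, .const 0, fun w ρ σ => by simp [WMSO.eval]⟩
  | insert c s hc ih =>
    obtain ⟨ψ, hψ, h⟩ := ih
    obtain ⟨β, hβ⟩ := hf c
    refine ⟨.or (.and (.const (G c)) (.bool β)) ψ,
      .or (.and (.const _) (.boolean trivial)) hψ, fun w ρ σ => ?_⟩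
    simp [WMSO.eval, hβ, h, Finset.sum_insert hc]

/-- `y` is the position next to `x`. -/
def IsNext {N : ℕ} (x y : Fin N) : Prop := ¬ y ≤ x ∧ ∀ z, z ≤ x ∨ y ≤ z

theorem isNext_castSucc {N : ℕ} (i : Fin N) (y : Fin (N + 1)) :
    IsNext i.castSucc y ↔ y = i.succ := by
  constructor
  · rintro ⟨h1, h2⟩
    have h3 := h2 i.succ
    simp only [Fin.le_def, Fin.ext_iff, Fin.val_castSucc, Fin.val_succ] at *
    omega
  · rintro rfl
    refine ⟨by simp [Fin.le_def], fun z => ?_⟩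
    simp only [Fin.le_def, Fin.val_castSucc, Fin.val_succ]
    omega

theorem isDefinable_letter (a : X) :
    IsDefinable fun w (ρ : Fin 1 → _) (_ : Fin m → _) => w.get (ρ 0) = a :=
  ⟨.letter a 0, fun _ _ _ => Iff.rfl⟩

theorem isDefinable_mem (j : Fin m) :
    IsDefinable fun (w : List X) (ρ : Fin 1 → Fin w.length) σ => ρ 0 ∈ σ j :=
  ⟨.mem 0 j, fun _ _ _ => Iff.rfl⟩

theorem isDefinable_first :
    IsDefinable fun (w : List X) (ρ : Fin 1 → Fin w.length) (_ : Fin m → _) => ∀ y, ρ 0 ≤ y :=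
  ⟨.allFO (.le 1 0), fun _ _ _ => Iff.rfl⟩

theorem isDefinable_last :
    IsDefinable fun (w : List X) (ρ : Fin 1 → Fin w.length) (_ : Fin m → _) => ∀ y, y ≤ ρ 0 :=
  ⟨.allFO (.le 0 1), fun _ _ _ => Iff.rfl⟩

theorem isDefinable_next_mem (j : Fin m) :
    IsDefinable fun (w : List X) (ρ : Fin 1 → Fin w.length) σ => ∃ y, IsNext (ρ 0) y ∧ y ∈ σ j := by
  refine ⟨.not (.allFO (.not (.and (.and (.not (.le 0 1))
    (.allFO (.not (.and (.not (.le 0 2)) (.not (.le 1 0)))))) (.mem 0 j)))), fun w ρ σ => ?_⟩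
  have h : ∀ y z : Fin w.length,
      (Fin.cons z (Fin.cons y ρ : Fin 2 → Fin w.length) : Fin 3 → Fin w.length) 2 = ρ 0 :=
    fun _ _ => rfl
  have h' : ∀ y : Fin w.length, (Fin.cons y ρ : Fin 2 → Fin w.length) 1 = ρ 0 := fun _ => rfl
  have h'' : ∀ y z : Fin w.length,
      (Fin.cons z (Fin.cons y ρ : Fin 2 → Fin w.length) : Fin 3 → Fin w.length) 1 = y :=
    fun _ _ => rfl
  simp only [BoolMSO.Sat, IsNext, Fin.cons_zero, h, h', h'']
  push Not
  simp only [or_iff_not_imp_left, not_le]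

/-- Iterated existential quantification over all set variables. -/
theorem WMSO.IsRestricted.exists_sum [Field k] {φ : WMSO k X 0 m} (hφ : φ.IsRestricted) :
    ∃ φ' : WMSO k X 0 0, φ'.IsRestricted ∧
      ∀ w ρ σ₀, φ'.eval w ρ σ₀ = ∑ σ : Fin m → Finset (Fin w.length), φ.eval w ρ σ := by
  induction m with
  | zero =>
    refine ⟨φ, hφ, fun w ρ σ₀ => ?_⟩
    rw [Fintype.sum_subsingleton _ σ₀]
  | succ m ih =>
    have hex : (WMSO.exSO φ).IsRestricted := hφ
    obtain ⟨φ', hφ', h⟩ := ih hex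
    refine ⟨φ', hφ', fun w ρ σ₀ => ?_⟩
    rw [h, sum_fun_succ, Finset.sum_comm]
    rfl

end Definability

/-! ### Recognisable series are definable -/

section RecognisableToDefinable

variable {k X : Type*} [Field k] {S : FormalSeries k X}

open scoped Classical in
/-- A weighted automaton with `n` states can be regarded as one whose states are the bit vectors of
length `n`, the original states being the unit vectors. Every family of `n` sets of positions then
corresponds to a sequence of states. -/
theorem IsRecognisable.exists_bit_vector_states (h : IsRecognisable S) :
    ∃ (n : ℕ) (lam : (Fin n → Bool) → k) (M : X → (Fin n → Bool) → (Fin n → Bool) → k)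
      (x : (Fin n → Bool) → FreeMonoid X → k),
      (∀ w, S w = ∑ t, lam t * x t w) ∧
        ∀ a t w, x t (FreeMonoid.of a * w) = ∑ t', M a t t' * x t' w := by
  obtain ⟨n, lam, mu, gam, h⟩ := h
  let e : Fin n → Fin n → Bool := fun p j => decide (p = j)
  have he : ∀ p q, e p = e q ↔ p = q := by
    refine fun p q => ⟨fun h => ?_, fun h => h ▸ rfl⟩
    have := congrFun h q
    simpa [e] using this
  let x : Fin n → FreeMonoid X → k := fun p w => (mu w).mulVec gam p
  have hx : ∀ a p w, x p (FreeMonoid.of a * w) = ∑ q, mu (FreeMonoid.of a) p q * x q w := by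
    intro a p w
    simp only [x, map_mul, ← Matrix.mulVec_mulVec]
    simp [Matrix.mulVec, dotProduct]
  have hsum : ∀ (F : (Fin n → Bool) → k) (w : FreeMonoid X),
      ∑ t, F t * (∑ q, if e q = t then x q w else 0) = ∑ q, F (e q) * x q w := by
    intro F w
    simp only [Finset.mul_sum, mul_ite, mul_zero]
    rw [Finset.sum_comm]
    simp
  refine ⟨n, fun t => ∑ p, if e p = t then lam p else 0,
    fun a t t' => ∑ p, ∑ q, if e q = t' then if e p = t then mu (FreeMonoid.of a) p q else 0 else 0,
    fun t w => ∑ q, if e q = t then x q w else 0, fun w => ?_, fun a t w => ?_⟩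
  · rw [hsum, h w]
    simp [he, dotProduct, x]
  · rw [hsum]
    simp only [hx, he, Finset.sum_ite_eq', Finset.mem_univ, if_true, Finset.sum_mul, ite_mul,
      zero_mul]
    rw [Finset.sum_comm]
    refine Finset.sum_congr rfl fun p _ => ?_
    split_ifs <;> simp

variable {Q : Type*} [Fintype Q] {lam : Q → k} {M : X → Q → Q → k} {x : Q → FreeMonoid X → k}

/-- The behaviour of an automaton from the state `q`, as a sum over paths. -/
theorem eq_sum_paths (hx : ∀ a t w, x t (FreeMonoid.of a * w) = ∑ t', M a t t' * x t' w)
    {N : ℕ} (s : Fin (N + 1) → X) (q : Q) :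
    x q (word s) = ∑ t : Fin N → Q,
      (∏ i : Fin N, M (s i.castSucc) ((Fin.cons q t : Fin (N + 1) → Q) i.castSucc) (t i)) *
        x ((Fin.cons q t : Fin (N + 1) → Q) (Fin.last N)) (FreeMonoid.of (s (Fin.last N))) := by
  induction N generalizing q with
  | zero =>
    rw [word_succ]
    simp
  | succ N ih =>
    rw [word_succ, hx, sum_fun_succ]
    refine Finset.sum_congr rfl fun q' _ => ?_
    rw [ih, Finset.mul_sum]
    refine Finset.sum_congr rfl fun t _ => ?_
    rw [Fin.prod_univ_succ, ← mul_assoc]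
    simp [← Fin.succ_last]

open scoped Classical in
/-- The contribution of the position `i` to the weight of the path `t` over the word `s`: the
initial weight is charged at the first position, the transition to the next state at each position
but the last, and the last letter together with the final weight at the last position. -/
def localWeight {n N : ℕ} (lam : (Fin n → Bool) → k)
    (M : X → (Fin n → Bool) → (Fin n → Bool) → k) (x : (Fin n → Bool) → FreeMonoid X → k)
    (s : Fin N → X) (t : Fin N → Fin n → Bool) (i : Fin N) : k :=
  (if ∀ y, i ≤ y then lam (t i) else 1) *
    if ∀ y, y ≤ i then x (t i) (FreeMonoid.of (s i))
    else M (s i) (t i) fun j => decide (∃ y, IsNext i y ∧ t y j = true)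

theorem sum_eq_sum_prod_localWeight {n N : ℕ} {lam : (Fin n → Bool) → k}
    {M : X → (Fin n → Bool) → (Fin n → Bool) → k} {x : (Fin n → Bool) → FreeMonoid X → k}
    (hx : ∀ a t w, x t (FreeMonoid.of a * w) = ∑ t', M a t t' * x t' w) (hN : N ≠ 0)
    (s : Fin N → X) :
    ∑ q, lam q * x q (word s) =
      ∑ t : Fin N → Fin n → Bool, ∏ i, localWeight lam M x s t i := by
  obtain ⟨N, rfl⟩ := Nat.exists_eq_succ_of_ne_zero hN
  have hfirst : ∀ i : Fin (N + 1), (∀ y, i ≤ y) ↔ i = 0 :=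
    fun i => ⟨fun h => Fin.le_zero_iff.mp (h 0), fun h y => h ▸ Fin.zero_le y⟩
  have hlast : ∀ i : Fin (N + 1), (∀ y, y ≤ i) ↔ i = Fin.last N :=
    fun i => ⟨fun h => Fin.last_le_iff.mp (h _), fun h y => h ▸ Fin.le_last y⟩
  rw [sum_fun_succ]
  refine Finset.sum_congr rfl fun q _ => ?_
  rw [eq_sum_paths hx, Finset.mul_sum]
  refine Finset.sum_congr rfl fun t _ => ?_
  simp only [localWeight, Finset.prod_mul_distrib, hfirst, hlast]
  rw [Finset.prod_ite_eq_of_mem' _ _ _ (Finset.mem_univ _), Fin.prod_univ_castSucc]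
  simp [isNext_castSucc, (Fin.castSucc_lt_last _).ne]

open scoped Classical in
theorem IsRecognisable.isRwMSODefinable [Finite X] (h : IsRecognisable S) :
    IsRwMSODefinable S := by
  obtain ⟨n, lam, M, x, hS, hx⟩ := h.exists_bit_vector_states
  -- The letter, the state, being first or last, and the next state of a position are definable.
  have hdata : HasDefinableFibres fun (w : List X) (ρ : Fin 1 → Fin w.length)
      (σ : Fin n → Finset (Fin w.length)) =>
      (w.get (ρ 0), (fun j => decide (ρ 0 ∈ σ j)), decide (∀ y, ρ 0 ≤ y), decide (∀ y, y ≤ ρ 0),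
        fun j => decide (∃ y, IsNext (ρ 0) y ∧ y ∈ σ j)) :=
    .prodMk isDefinable_letter (.prodMk (.pi fun j => (isDefinable_mem j).hasDefinableFibres)
      (.prodMk isDefinable_first.hasDefinableFibres (.prodMk isDefinable_last.hasDefinableFibres
        (.pi fun j => (isDefinable_next_mem j).hasDefinableFibres))))
  obtain ⟨ψ, hψ, hψ'⟩ := hdata.isAlmostBooleanDefinable fun c =>
    (if c.2.2.1 = true then lam c.2.1 else 1) *
      if c.2.2.2.1 = true then x c.2.1 (FreeMonoid.of c.1) else M c.1 c.2.1 c.2.2.2.2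
  have hall : (WMSO.allFO ψ).IsRestricted := hψ
  obtain ⟨φ, hφ, hφ'⟩ := hall.exists_sum
  have hφ_eval : ∀ (w : List X) ρ σ₀, φ.eval w ρ σ₀ =
      ∑ t : Fin w.length → Fin n → Bool, ∏ i, localWeight lam M x w.get t i := by
    intro w ρ σ₀
    rw [hφ', ← ((Equiv.piCongrRight fun _ : Fin n => markingEquiv (Fin w.length)).trans
      (Equiv.piComm fun _ _ => Bool)).sum_comp]
    refine Finset.sum_congr rfl fun σ _ => Finset.prod_congr rfl fun i _ => ?_
    change _ = localWeight lam M x w.get (fun i j => decide (i ∈ σ j)) i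
    rw [hψ']
    simp [localWeight]
  -- At the empty word `φ` has the value `1`, an empty product, which has to be corrected.
  refine ⟨.or (.and (.const (S 1 - 1)) (.bool (.allFO (.not (.le 0 0))))) φ,
    by simpa [WMSO.IsRestricted] using hφ, fun w => ?_⟩
  simp only [WMSO.eval, BoolMSO.Sat, hφ_eval]
  by_cases hw : w = 1
  · subst hw
    have : IsEmpty (Fin (FreeMonoid.toList (1 : FreeMonoid X)).length) :=
      inferInstanceAs (IsEmpty (Fin 0))
    simp only [Finset.univ_eq_empty, Finset.prod_empty, Fintype.sum_unique]
    simp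
  · have hN : w.toList.length ≠ 0 := fun h => hw (FreeMonoid.length_eq_zero.mp h)
    have hne : ¬ ∀ i : Fin w.toList.length, ¬ i ≤ i := fun h =>
      h ⟨0, Nat.pos_of_ne_zero hN⟩ le_rfl
    rw [← sum_eq_sum_prod_localWeight hx hN, word_get, ← hS]
    simp only [Fin.cons_zero, if_neg hne, mul_zero, zero_add]

end RecognisableToDefinable

end NCSeries

end

theorem mainTheorem7 {k : Type*} [Field k] [CharZero k] {X : Type*} [Finite X]
    (S : NCSeries.FormalSeries k X) :
    [FiniteDimensional k (NCSeries.SyntacticAlgebra S),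
      NCSeries.IsRational S,
      NCSeries.IsRecognisable S,
      NCSeries.IsRwMSODefinable S].TFAE := by
  tfae_have 1 → 3 := NCSeries.isRecognisable_of_finiteDimensional
  tfae_have 3 → 1 := NCSeries.IsRecognisable.finiteDimensional
  tfae_have 2 → 3 := fun h => h.hasFiniteRankQuotients.isRecognisable
  tfae_have 3 → 2 := NCSeries.IsRecognisable.isRational
  tfae_have 3 → 4 := NCSeries.IsRecognisable.isRwMSODefinable
  tfae_have 4 → 3 := fun h => h.hasFiniteRankQuotients.isRecognisable
  tfae_finish
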